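/- For $\alpha\in(0,1)$ let $A_\alpha$ be the universal $C^*$-algebra generated by two unitaries $u,v$ with $uv=e^{2\pi i\alpha}vu$, let $\tau$ be its canonical trace, $\tau\big(\sum a_{m,n}u^mv^n\big)=a_{0,0}$, let $\sigma$ be the automorphism of $A_\alpha$ with $\sigma(u)=v$, $\sigma(v)=u^{-1}$, and let $A_\alpha^\sigma=\{x\in A_\alpha:\sigma(x)=x\}$. For an integer $q\ge 2$ let $M=\mathbb R\times\mathbb Z/q\mathbb Z$, with Lebesgue measure on $\mathbb R$ and mass $q^{-1/2}$ at each point of $\mathbb Z/q\mathbb Z$, let $\langle (s,n),(y,m)\rangle=e^{2\pi i sy}e^{2\pi i nm/q}$ be the pairing of $M$ with itself, and for $x=(x',x'')\in M\times M$ let $\pi_x$ be the unitary operator $(\pi_xf)(t)=\langle t,x''\rangle f(t+x')$ on $L^2(M)$. For $\gamma>0$ and $r\in\mathbb Z$ let $D\subset M\times M$ be the subgroup generated by $\big((\sqrt\gamma,[r]),(0,[0])\big)$ and $\big((0,[0]),(\sqrt\gamma,[r])\big)$, let $D^\perp$ be the set of all $z\in M\times M$ with $\langle w',z''\rangle=\langle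 z',w''\rangle$ for all $w\in D$, let $\tilde\phi(s,[n])=e^{-\pi s^2}(1+\sqrt q\,\delta_{[n],[0]})$, and let $$a_{\gamma,r}=\sum_{z\in D^\perp}\Big(\int_M\overline{\tilde\phi(t)}\,\tilde\phi(t+z')\,\langle t,z''\rangle\,dt\Big)\,\pi_z^*$$ (a sum of operators on $L^2(M)$). **Proposition.** Let $\alpha\in(0,1)$, let $q\ge 2$ and $p$ be integers with $\gcd(p,q)=1$. (i) If $0<\alpha-\frac pq<\frac{0.948}{q^2}$ and $p_0\in\mathbb Z$ satisfies $p\equiv p_0^2 \pmod q$, then $a_{\gamma,p_0}$ with $\gamma=\alpha-\frac pq$ is an invertible bounded operator, and $A_\alpha^\sigma$ contains a projection of trace $q\alpha-p$. (ii) If $0<\frac pq-\alpha<\frac{0.948}{q^2}$ and $p_1\in\mathbb Z$ satisfies $p\equiv -p_1^2 \pmod q$, then $a_{\gamma',p_1}$ with $\gamma'=\frac pq-\alpha$ is an invertible bounded operator, and $A_\alpha^\sigma$ contains a projection of trace $p-q\alpha$. -/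

import Mathlib

open MeasureTheory
open scoped ENNReal NNReal ComplexConjugate BoundedContinuousFunction

noncomputable section

namespace RotationAlgebra

/-! ### The rotation algebra

`A_α` is the universal C⋆-algebra generated by two unitaries `u`, `v` with
`u v = e^{2πiα} v u`.  A C⋆-algebra generated by two unitaries is separable, so it is faithfully
and unitally represented on a separable infinite dimensional Hilbert space.  Hence the universal
C⋆-algebra is the C⋆-algebra generated by the two families `(U)` and `(V)`, where `(U, V)` runs over
all pairs of unitaries with this relation on one such space. -/

/-- The separable infinite dimensional Hilbert space `ℓ²(ℤ²)`. -/
def Hil : Type := lp (fun _ : ℤ × ℤ => ℂ) 2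

instance : NormedAddCommGroup Hil :=
  inferInstanceAs (NormedAddCommGroup (lp (fun _ : ℤ × ℤ => ℂ) 2))

instance : InnerProductSpace ℂ Hil :=
  inferInstanceAs (InnerProductSpace ℂ (lp (fun _ : ℤ × ℤ => ℂ) 2))

instance : CompleteSpace Hil := inferInstanceAs (CompleteSpace (lp (fun _ : ℤ × ℤ => ℂ) 2))

/-- The coordinates of a vector of `ℓ²(ℤ²)`. -/
def Hil.coord (f : Hil) : ℤ × ℤ → ℂ := Subtype.val (p := (· ∈ lp (fun _ : ℤ × ℤ => ℂ) 2)) f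

lemma Hil.ext {f g : Hil} (h : ∀ i, f.coord i = g.coord i) : f = g := Subtype.ext (funext h)

/-- The unit vector `δ_i` of `ℓ²(ℤ²)`. -/
def delta (i : ℤ × ℤ) : Hil := (lp.single 2 i (1 : ℂ) : lp (fun _ : ℤ × ℤ => ℂ) 2)

lemma delta_coord (i j : ℤ × ℤ) : (delta i).coord j = if j = i then 1 else 0 := by
  change (lp.single 2 i (1 : ℂ) : lp (fun _ : ℤ × ℤ => ℂ) 2) j = _
  rw [lp.single_apply, Pi.single_apply]

instance : Nontrivial Hil :=
  ⟨⟨delta 0, 0, fun h => by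
    have := congrArg (fun f => Hil.coord f 0) h
    rw [delta_coord, if_pos rfl] at this
    exact one_ne_zero this⟩⟩

/-- The phase `e^{2πiα}` as a point of the unit circle. -/
def phase (α : ℝ) : Circle := Circle.exp (2 * Real.pi * α)

/-- A representation of the rotation relation: unitaries on `ℓ²(ℤ²)` with `U V = e^{2πiα} V U`. -/
@[ext] structure RotPair (α : ℝ) where
  /-- the image of `u` -/
  U : unitary (Hil →L[ℂ] Hil)
  /-- the image of `v` -/
  V : unitary (Hil →L[ℂ] Hil)
  comm : (U : Hil →L[ℂ] Hil) * V = (phase α : ℂ) • ((V : Hil →L[ℂ] Hil) * U)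

/-- The index set carries the discrete topology: all families are continuous. -/
instance (α : ℝ) : TopologicalSpace (RotPair α) := ⊥

instance (α : ℝ) : DiscreteTopology (RotPair α) := ⟨rfl⟩

/-- The C⋆-algebra of bounded families of operators on `ℓ²(ℤ²)` indexed by all representations, with
pointwise operations and the supremum norm. -/
def Ambient (α : ℝ) : Type := RotPair α →ᵇ (Hil →L[ℂ] Hil)

instance (α : ℝ) : CStarAlgebra (Ambient α) :=
  inferInstanceAs (CStarAlgebra (RotPair α →ᵇ (Hil →L[ℂ] Hil)))

/-- The component of a bounded family at one representation. -/
def eval {α : ℝ} (r : RotPair α) : Ambient α →⋆ₐ[ℂ] (Hil →L[ℂ] Hil) where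
  toFun a := BoundedContinuousFunction.toContinuousMap a r
  map_one' := rfl
  map_mul' _ _ := rfl
  map_zero' := rfl
  map_add' _ _ := rfl
  commutes' _ := rfl
  map_star' _ := rfl

lemma Ambient.ext {α : ℝ} {a b : Ambient α} (h : ∀ r, eval r a = eval r b) : a = b :=
  BoundedContinuousFunction.ext h

lemma Ambient.norm_le {α : ℝ} {a : Ambient α} {C : ℝ} (hC : 0 ≤ C) :
    ‖a‖ ≤ C ↔ ∀ r, ‖eval r a‖ ≤ C :=
  BoundedContinuousFunction.norm_le hC

lemma norm_unitary_le (U : unitary (Hil →L[ℂ] Hil)) : ‖(U : Hil →L[ℂ] Hil)‖ ≤ 1 :=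
  (CStarRing.norm_of_mem_unitary U.2).le

/-- The universal generator `u`. -/
def uAmb (α : ℝ) : Ambient α :=
  BoundedContinuousFunction.ofNormedAddCommGroupDiscrete (fun r => (r.U : Hil →L[ℂ] Hil)) 1
    fun r => norm_unitary_le r.U

/-- The universal generator `v`. -/
def vAmb (α : ℝ) : Ambient α :=
  BoundedContinuousFunction.ofNormedAddCommGroupDiscrete (fun r => (r.V : Hil →L[ℂ] Hil)) 1
    fun r => norm_unitary_le r.V

lemma eval_u {α : ℝ} (r : RotPair α) : eval r (uAmb α) = r.U := rfl

lemma eval_v {α : ℝ} (r : RotPair α) : eval r (vAmb α) = r.V := rfl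

/-- The rotation algebra `A_α`: the closed unital ⋆-subalgebra generated by `u` and `v`. -/
def rotationAlgebra (α : ℝ) : StarSubalgebra ℂ (Ambient α) :=
  (StarAlgebra.adjoin ℂ {uAmb α, vAmb α}).topologicalClosure

/-- The generator `u` of `A_α`. -/
def u (α : ℝ) : rotationAlgebra α :=
  ⟨uAmb α, StarSubalgebra.le_topologicalClosure _ (StarAlgebra.subset_adjoin ℂ _ (by simp))⟩

/-- The generator `v` of `A_α`. -/
def v (α : ℝ) : rotationAlgebra α :=
  ⟨vAmb α, StarSubalgebra.le_topologicalClosure _ (StarAlgebra.subset_adjoin ℂ _ (by simp))⟩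

/-! ### The automorphism `σ` -/

/-- If `(U, V)` is a representation, so is `(V, U⁻¹)`. -/
def RotPair.rotate {α : ℝ} (r : RotPair α) : RotPair α where
  U := r.V
  V := star r.U
  comm := by
    have h := r.comm
    have h1 : (star (r.U : Hil →L[ℂ] Hil)) * r.U = 1 := Unitary.coe_star_mul_self r.U
    have h2 : (r.U : Hil →L[ℂ] Hil) * star (r.U : Hil →L[ℂ] Hil) = 1 :=
      Unitary.coe_mul_star_self r.U
    have h3 := congrArg (fun T => star (r.U : Hil →L[ℂ] Hil) * T * star (r.U : Hil →L[ℂ] Hil)) h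
    simp only [mul_smul_comm, smul_mul_assoc] at h3
    rw [← mul_assoc, h1, one_mul, ← mul_assoc, mul_assoc _ _ (star (r.U : Hil →L[ℂ] Hil)), h2,
      mul_one] at h3
    exact h3

/-- Composition of a bounded family with the map `(U, V) ↦ (V, U⁻¹)` of the index set. -/
def sigmaAmb (α : ℝ) : Ambient α →⋆ₐ[ℂ] Ambient α where
  toFun a := BoundedContinuousFunction.compContinuous a ⟨RotPair.rotate, continuous_of_discreteTopology⟩
  map_one' := rfl
  map_mul' _ _ := rfl
  map_zero' := rfl
  map_add' _ _ := rfl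
  commutes' _ := rfl
  map_star' _ := rfl

lemma eval_sigmaAmb {α : ℝ} (a : Ambient α) (r : RotPair α) :
    eval r (sigmaAmb α a) = eval r.rotate a := rfl

lemma sigmaAmb_u (α : ℝ) : sigmaAmb α (uAmb α) = vAmb α := rfl

lemma sigmaAmb_v (α : ℝ) : sigmaAmb α (vAmb α) = star (uAmb α) := rfl

lemma map_mem_closure_adjoin {A : Type} [CStarAlgebra A] (φ : A →⋆ₐ[ℂ] A) (hφ : Continuous φ)
    {a b : A} (ha : φ a = b) (hb : φ b = star a) {x : A}
    (hx : x ∈ (StarAlgebra.adjoin ℂ {a, b}).topologicalClosure) :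
    φ x ∈ (StarAlgebra.adjoin ℂ {a, b}).topologicalClosure := by
  have hle : StarAlgebra.adjoin ℂ {a, b} ≤ (StarAlgebra.adjoin ℂ {a, b}).comap φ := by
    refine StarAlgebra.adjoin_le ?_
    have h1 : a ∈ StarAlgebra.adjoin ℂ {a, b} := StarAlgebra.subset_adjoin ℂ {a, b} (Or.inl rfl)
    have h2 : b ∈ StarAlgebra.adjoin ℂ {a, b} := StarAlgebra.subset_adjoin ℂ {a, b} (Or.inr rfl)
    rintro y (rfl | rfl)
    · change φ y ∈ StarAlgebra.adjoin ℂ {y, b}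
      rwa [ha]
    · change φ y ∈ StarAlgebra.adjoin ℂ {a, y}
      rw [hb]
      exact star_mem h1
  exact map_mem_closure hφ hx fun y hy => hle hy

lemma continuous_sigmaAmb (α : ℝ) : Continuous (sigmaAmb α) := by
  refine AddMonoidHomClass.continuous_of_bound (sigmaAmb α) 1 fun x => ?_
  rw [one_mul]
  exact (Ambient.norm_le (norm_nonneg x)).2 fun r =>
    (Ambient.norm_le (norm_nonneg x)).1 le_rfl r.rotate

lemma sigmaAmb_mem {α : ℝ} {a : Ambient α} (ha : a ∈ rotationAlgebra α) :
    sigmaAmb α a ∈ rotationAlgebra α :=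
  map_mem_closure_adjoin (sigmaAmb α) (continuous_sigmaAmb α) (sigmaAmb_u α) (sigmaAmb_v α) ha

/-- The endomorphism of `A_α` with `u ↦ v`, `v ↦ u⁻¹`. -/
def sigmaHom (α : ℝ) : rotationAlgebra α →⋆ₐ[ℂ] rotationAlgebra α :=
  ((sigmaAmb α).comp (rotationAlgebra α).subtype).codRestrict (rotationAlgebra α)
    fun a => sigmaAmb_mem a.2

lemma RotPair.rotate_four {α : ℝ} (r : RotPair α) : r.rotate.rotate.rotate.rotate = r := by
  ext1 <;> simp [RotPair.rotate]

lemma sigmaHom_four {α : ℝ} (a : rotationAlgebra α) :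
    sigmaHom α (sigmaHom α (sigmaHom α (sigmaHom α a))) = a := by
  apply Subtype.ext
  refine Ambient.ext fun r => ?_
  change eval r.rotate.rotate.rotate.rotate (a : Ambient α) = eval r (a : Ambient α)
  rw [RotPair.rotate_four]

/-- The automorphism `σ` of `A_α` with `σ(u) = v`, `σ(v) = u⁻¹`. -/
def sigma (α : ℝ) : rotationAlgebra α ≃⋆ₐ[ℂ] rotationAlgebra α :=
  StarAlgEquiv.ofStarAlgHom (sigmaHom α) ((sigmaHom α).comp ((sigmaHom α).comp (sigmaHom α)))
    (by ext1 a; exact sigmaHom_four a) (by ext1 a; exact sigmaHom_four a)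

lemma sigma_u (α : ℝ) : sigma α (u α) = v α := rfl

lemma sigma_v (α : ℝ) : sigma α (v α) = star (u α) := rfl

/-- The fixed point algebra `A_α^σ`. -/
def fixedAlgebra (α : ℝ) : StarSubalgebra ℂ (rotationAlgebra α) :=
  StarAlgHom.equalizer (sigma α : rotationAlgebra α →⋆ₐ[ℂ] rotationAlgebra α)
    (StarAlgHom.id ℂ (rotationAlgebra α))

lemma mem_fixedAlgebra {α : ℝ} {a : rotationAlgebra α} : a ∈ fixedAlgebra α ↔ sigma α a = a :=
  Iff.rfl

/-! ### The canonical trace -/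

/-- The isometry `f ↦ (i ↦ c i * f (e⁻¹ i))` of `ℓ²(ℤ²)`. -/
def weightedPerm (c : ℤ × ℤ → Circle) (e : Equiv.Perm (ℤ × ℤ)) : Hil →ₗᵢ[ℂ] Hil where
  toFun f := ⟨fun i => (c i : ℂ) * f.coord (e.symm i), by
    refine memℓp_gen ?_
    simp_rw [norm_mul, Circle.norm_coe, one_mul]
    exact (e.symm.summable_iff (f := fun i => ‖f.coord i‖ ^ (2 : ℝ≥0∞).toReal)).2
      ((lp.memℓp (f : lp (fun _ : ℤ × ℤ => ℂ) 2)).summable (by simp))⟩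
  map_add' f g := Hil.ext fun i => mul_add _ _ _
  map_smul' k f := Hil.ext fun i => mul_left_comm _ _ _
  norm_map' f := by
    refine (lp.norm_eq_tsum_rpow (p := 2) (by simp) _).trans
      (Eq.trans ?_ (lp.norm_eq_tsum_rpow (p := 2) (by simp) _).symm)
    congr 1
    refine Eq.trans (tsum_congr fun i => ?_)
      (e.symm.tsum_eq (fun i => ‖f.coord i‖ ^ (2 : ℝ≥0∞).toReal))
    change ‖(c i : ℂ) * f.coord (e.symm i)‖ ^ _ = _
    rw [norm_mul, Circle.norm_coe, one_mul]

lemma weightedPerm_coord (c : ℤ × ℤ → Circle) (e : Equiv.Perm (ℤ × ℤ)) (f : Hil) (i : ℤ × ℤ) :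
    (weightedPerm c e f).coord i = (c i : ℂ) * f.coord (e.symm i) := rfl

lemma weightedPerm_surjective (c : ℤ × ℤ → Circle) (e : Equiv.Perm (ℤ × ℤ)) :
    Function.Surjective (weightedPerm c e) := fun g =>
  ⟨weightedPerm (fun i => (c (e i))⁻¹) e.symm g, Hil.ext fun i => by
    simp [weightedPerm_coord]⟩

/-- `weightedPerm` as a unitary operator. -/
def weightedUnitary (c : ℤ × ℤ → Circle) (e : Equiv.Perm (ℤ × ℤ)) : unitary (Hil →L[ℂ] Hil) :=
  Unitary.linearIsometryEquiv.symm
    (LinearIsometryEquiv.ofSurjective (weightedPerm c e) (weightedPerm_surjective c e))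

lemma weightedUnitary_coord (c : ℤ × ℤ → Circle) (e : Equiv.Perm (ℤ × ℤ)) (f : Hil)
    (i : ℤ × ℤ) :
    ((weightedUnitary c e : Hil →L[ℂ] Hil) f).coord i = (c i : ℂ) * f.coord (e.symm i) := rfl

/-- The regular representation: `U δ_{m,n} = δ_{m+1,n}` and `V δ_{m,n} = e^{-2πiαm} δ_{m,n+1}`, so
that `U^m V^n δ_{0,0} = δ_{m,n}`. -/
def regularRep (α : ℝ) : RotPair α where
  U := weightedUnitary (fun _ => 1) (Equiv.addRight (1, 0))
  V := weightedUnitary (fun i => phase α ^ (-i.1)) (Equiv.addRight (0, 1))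
  comm := by
    refine ContinuousLinearMap.ext fun f => Hil.ext fun i => ?_
    change ((1 : Circle) : ℂ) * (((phase α ^ (-(i.1 + -1)) : Circle) : ℂ) *
        f.coord (i + (-1, 0) + (0, -1))) =
      (phase α : ℂ) * (((phase α ^ (-i.1) : Circle) : ℂ) * (((1 : Circle) : ℂ) *
        f.coord (i + (0, -1) + (-1, 0))))
    have : (phase α ^ (-(i.1 + -1)) : Circle) = phase α * phase α ^ (-i.1) := by
      rw [← zpow_one_add]; congr 1; ring
    rw [this, add_right_comm i (-1, 0) (0, -1), Circle.coe_mul, Circle.coe_one, one_mul, one_mul,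
      mul_assoc]

/-- The canonical trace `τ(∑ a_{m,n} u^m v^n) = a_{0,0}` of `A_α`: the vector state of `δ_{0,0}` in
the regular representation. -/
def trace (α : ℝ) : rotationAlgebra α →ₗ[ℂ] ℂ where
  toFun a := inner ℂ (delta 0) (eval (regularRep α) (a : Ambient α) (delta 0))
  map_add' _ _ := inner_add_right _ _ _
  map_smul' _ _ := inner_smul_right _ _ _

end RotationAlgebra

/-! ### Heisenberg operators on `L²(ℝ × ℤ/q)` -/

namespace Heisenberg

/-- The group `M = ℝ × ℤ/q`, identified with its dual group. -/
abbrev M (q : ℕ) : Type := ℝ × ZMod q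

/-- The group `G = M × M̂`. -/
abbrev G (q : ℕ) : Type := M q × M q

/-- The measure on `M`: Lebesgue measure times the Haar–Plancherel measure on `ℤ/q`, which gives
each point mass `q^{-1/2}`. -/
def haar (q : ℕ) : Measure (M q) :=
  (volume : Measure ℝ).prod (Real.toNNReal (1 / Real.sqrt q) • (Measure.count : Measure (ZMod q)))

instance (q : ℕ) : SigmaFinite (Measure.count : Measure (ZMod q)) := by
  cases q with
  | zero => exact inferInstanceAs (SigmaFinite (Measure.count : Measure ℤ))
  | succ n => infer_instance

/-- The Hilbert space `L²(M)`. -/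
abbrev L2 (q : ℕ) : Type := Lp ℂ 2 (haar q)

variable {q : ℕ}

/-- The pairing `⟨(s, n), (y, m)⟩ = e^{2πi s y} e^{2πi n m / q}` of `M` with its dual. -/
def pairing [NeZero q] (x y : M q) : Circle :=
  Real.fourierChar (x.1 * y.1) * ZMod.toCircle (x.2 * y.2)

/-- The Heisenberg bicharacter `β((x₁, y₁), (x₂, y₂)) = ⟨x₁, y₂⟩`. -/
def bichar [NeZero q] (w z : G q) : Circle := pairing w.1 z.2

lemma measurable_pairing [NeZero q] (y : M q) : Measurable fun t : M q => (pairing t y : ℂ) := by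
  have h1 : Measurable fun t : M q => ((Real.fourierChar (t.1 * y.1) : Circle) : ℂ) := by
    have : Continuous fun s : ℝ => ((Real.fourierChar (s * y.1) : Circle) : ℂ) :=
      continuous_subtype_val.comp (Real.continuous_fourierChar.comp (continuous_mul_const _))
    exact this.measurable.comp measurable_fst
  have h2 : Measurable fun t : M q => ((ZMod.toCircle (t.2 * y.2) : Circle) : ℂ) :=
    (measurable_of_countable fun n : ZMod q => ((ZMod.toCircle (n * y.2) : Circle) : ℂ)).comp
      measurable_snd
  have h3 : (fun t : M q => (pairing t y : ℂ)) = (fun t : M q =>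
      ((Real.fourierChar (t.1 * y.1) : Circle) : ℂ) * ((ZMod.toCircle (t.2 * y.2) : Circle) : ℂ)) :=
    funext fun t => Circle.coe_mul _ _
  rw [h3]
  exact h1.mul h2

lemma measurePreserving_add (x : M q) : MeasurePreserving (· + x) (haar q) (haar q) := by
  have h2 : MeasurePreserving (· + x.2) (Real.toNNReal (1 / Real.sqrt q) •
      (Measure.count : Measure (ZMod q))) (Real.toNNReal (1 / Real.sqrt q) •
      (Measure.count : Measure (ZMod q))) :=
    (MeasureTheory.measurePreserving_add_right (Measure.count : Measure (ZMod q)) x.2).smul_measure _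
  exact (MeasureTheory.measurePreserving_add_right (volume : Measure ℝ) x.1).prod h2

lemma norm_pairing_mul [NeZero q] (t y : M q) (c : ℂ) : ‖(pairing t y : ℂ) * c‖ = ‖c‖ := by
  rw [norm_mul, Circle.norm_coe, one_mul]

lemma memLp_heis [NeZero q] (x : G q) (f : L2 q) :
    MemLp (fun t => (pairing t x.2 : ℂ) * f (t + x.1)) 2 (haar q) := by
  have h : MemLp (fun t => f (t + x.1)) 2 (haar q) :=
    (Lp.memLp f).comp_measurePreserving (measurePreserving_add x.1)
  exact h.of_le ((measurable_pairing x.2).aestronglyMeasurable.mul h.1)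
    (Filter.Eventually.of_forall fun t => (norm_pairing_mul _ _ _).le)

/-- The Heisenberg operators `(π_{(x', x'')} f)(t) = ⟨t, x''⟩ f(t + x')` on `L²(M)`. -/
def heis [NeZero q] (x : G q) : L2 q →ₗᵢ[ℂ] L2 q where
  toFun f := (memLp_heis x f).toLp _
  map_add' f g := by
    rw [← MemLp.toLp_add, MemLp.toLp_eq_toLp_iff]
    filter_upwards [(measurePreserving_add x.1).quasiMeasurePreserving.ae (Lp.coeFn_add f g)]
      with t ht
    simp only [Pi.add_apply] at ht ⊢
    rw [ht, mul_add]
  map_smul' c f := by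
    rw [RingHom.id_apply, ← MemLp.toLp_const_smul, MemLp.toLp_eq_toLp_iff]
    filter_upwards [(measurePreserving_add x.1).quasiMeasurePreserving.ae (Lp.coeFn_smul c f)]
      with t ht
    simp only [Pi.smul_apply, smul_eq_mul] at ht ⊢
    rw [ht, mul_left_comm]
  norm_map' f := by
    change ‖(memLp_heis x f).toLp _‖ = ‖f‖
    rw [Lp.norm_toLp, Lp.norm_def]
    congr 1
    rw [← eLpNorm_comp_measurePreserving (Lp.aestronglyMeasurable f) (measurePreserving_add x.1)]
    exact eLpNorm_congr_norm_ae (Filter.Eventually.of_forall fun t => norm_pairing_mul _ _ _)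

/-- The subgroup `D = ℤ ε₁ + ℤ ε₂` with `ε₁ = (√γ, [p₀], 0, [0])`, `ε₂ = (0, [0], √γ, [p₀])`. -/
def lattice (q : ℕ) (γ : ℝ) (p₀ : ℤ) : AddSubgroup (G q) :=
  AddSubgroup.closure {((Real.sqrt γ, (p₀ : ZMod q)), 0), (0, (Real.sqrt γ, (p₀ : ZMod q)))}

/-- `D^⊥ = {z | β(w, z) = β(z, w) for all w ∈ D}`. -/
def orth [NeZero q] (D : AddSubgroup (G q)) : Set (G q) :=
  {z | ∀ w ∈ D, bichar w z = bichar z w}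

/-- The values `⟨f, g⟩_{D^⊥}(z) = ∫_M conj(f(s)) g(s + z') ⟨s, z''⟩ ds` of the inner product. -/
def innerCoeff [NeZero q] (f g : M q → ℂ) (z : G q) : ℂ :=
  ∫ s, conj (f s) * g (s + z.1) * (pairing s z.2 : ℂ) ∂(haar q)

/-- The inner product `⟨f, g⟩_{D^⊥} = ∑_{z ∈ D^⊥} ⟨f, g⟩_{D^⊥}(z) π_z^*`, a norm convergent sum of
operators on `L²(M)`. -/
def innerOrth [NeZero q] (D : AddSubgroup (G q)) (f g : M q → ℂ) : L2 q →L[ℂ] L2 q :=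
  ∑' z : orth D, innerCoeff f g z •
    ContinuousLinearMap.adjoint (heis (z : G q)).toContinuousLinearMap

/-- The function `φ̃(s, [n]) = e^{-π s²} (1 + √q δ_{[0],[n]})` on `M`. -/
def phiTilde (q : ℕ) (t : M q) : ℂ :=
  Real.exp (-Real.pi * t.1 ^ 2) * (1 + if t.2 = 0 then (Real.sqrt q : ℂ) else 0)

/-- The element `a = ⟨φ̃, φ̃⟩_{D^⊥}` for `D = ℤ ε₁ + ℤ ε₂`. -/
def thetaElement (q : ℕ) [NeZero q] (γ : ℝ) (p₀ : ℤ) : L2 q →L[ℂ] L2 q :=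
  innerOrth (lattice q γ p₀) (phiTilde q) (phiTilde q)

end Heisenberg

end

/-! Write `φ` for the window `φ̃`, `π` for the Heisenberg representation and `a = ∑ ⟨φ, π_z φ⟩
π_z^*`, the sum being over `D^⊥`. The term `z = 0` is `‖φ‖²` times the identity. The coefficients at
`z ∈ D^⊥` are at most `‖φ‖²` times a Gaussian in the real part of `z`, and those real parts form the
square lattice of step `1/(q√γ)`. Their absolute values therefore sum to at most `‖φ‖² θ²`, where `θ
= ∑ exp(-π k² / (2 q² γ))`. The hypothesis `q² γ < 0.948` forces `θ < √2`, so the zero term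
dominates all the others together and `a` is invertible by a Neumann series (`isUnit_frame`,
`tsum_norm_coeff_grid_lt`).

Let `ψ = a⁻¹ φ` be the dual window and put `E(w) = qγ ⟨π_w φ, ψ⟩` for `w ∈ D`. The cocycle of `π` on
`D` is that of the monomials `v^n u^m` in `A_α`, with `u` and `v` exchanged in case (ii), so `∑ E(w)
v^n u^m` is the required projection once `E` is shown to be summable, idempotent and self-adjoint
for twisted convolution, and invariant under the quarter turn, with `E(0) = qγ`.

Self-adjointness holds because `a` is self-adjoint and commutes with `π_w` for `w ∈ D`. Idempotence
also needs the identity `qγ ∑_{w ∈ D} ⟨f, π_w φ⟩ ⟨π_w φ, g⟩ = ⟨f, a g⟩` for translates `f`, `g` of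
`φ`. This is Janssen's representation of the frame operator, obtained in `tsum_inner_window` from
Fourier inversion on `ℤ/q` and Poisson summation on `ℝ`.

The other properties reuse the diagonal dominance. Along each coset of `D^⊥` the numbers `⟨π_x φ,
ψ⟩` solve a convolution system whose bounded solutions are unique and obey a maximum principle. This
gives summability, `⟨φ, ψ⟩ = 1`, and the passage of the Fourier symmetry from `φ` to `ψ`. Neither a
square root of `a` nor irreducibility of `π` is needed. -/

/-! ### Gabor systems over a projective representation -/

/-- A projective representation of an abelian group by isometries, with bicharacter cocycle. -/
structure ProjRep (G H : Type*) [AddCommGroup G] [NormedAddCommGroup H] [InnerProductSpace ℂ H] where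
  /-- the cocycle -/
  β : G → G → Circle
  /-- the operators -/
  op : G → H →ₗᵢ[ℂ] H
  add_left : ∀ x y z, β (x + y) z = β x z * β y z
  add_right : ∀ x y z, β x (y + z) = β x y * β x z
  op_op : ∀ x y f, op x (op y f) = (β x y : ℂ) • op (x + y) f
  op_zero : ∀ f, op 0 f = f

/-- Solve for the `i`-th term and estimate the rest by the triangle inequality. The factor 2 appears
because `‖f i‖` is added to both sides to complete the sum of norms. -/
lemma two_mul_norm_le_of_summable {J : Type*} {f : J → ℂ} (hf : Summable fun j => ‖f j‖) (i : J) :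
    2 * ‖f i‖ ≤ ‖∑' j, f j‖ + ∑' j, ‖f j‖ := by
  classical
  have h1 := hf.of_norm.tsum_eq_add_tsum_ite i
  have h2 := hf.tsum_eq_add_tsum_ite i
  have h3 : ‖∑' j, (if j = i then 0 else f j)‖ ≤ ∑' j, if j = i then 0 else ‖f j‖ := by
    have hs : Summable fun j => ‖if j = i then 0 else f j‖ := by
      refine hf.of_nonneg_of_le (fun _ => norm_nonneg _) fun j => ?_
      split_ifs <;> simp
    refine (norm_tsum_le_tsum_norm hs).trans (le_of_eq (tsum_congr fun j => ?_))
    split_ifs <;> simp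
  have h4 : ‖f i‖ ≤ ‖∑' j, f j‖ + ‖∑' j, (if j = i then 0 else f j)‖ := by
    have : f i = (∑' j, f j) - ∑' j, (if j = i then 0 else f j) := by rw [h1]; ring
    calc ‖f i‖ = _ := by rw [this]
      _ ≤ _ := norm_sub_le _ _
  linarith

/-- A maximum principle for diagonally dominant convolution inequalities. -/
lemma le_of_diagonally_dominant {J : Type*} [AddCommGroup J] {k : J → ℝ} (hk : ∀ j, 0 ≤ k j)
    (hs : Summable k) {t : J → ℝ} (ht0 : ∀ i, 0 ≤ t i) {B : ℝ} (htb : ∀ i, t i ≤ B) {C : ℝ}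
    (h : ∀ i, 2 * k 0 * t i ≤ C + ∑' j, k j * t (j + i)) (i : J) :
    (2 * k 0 - ∑' j, k j) * t i ≤ C ∨ 2 * k 0 ≤ ∑' j, k j := by
  by_contra! hcon
  obtain ⟨h1, h2⟩ := hcon
  have hbdd : BddAbove (Set.range t) := ⟨B, by rintro _ ⟨i, rfl⟩; exact htb i⟩
  set T := ⨆ i, t i with hT
  have hle : ∀ i, t i ≤ T := le_ciSup hbdd
  have hS : ∀ i, ∑' j, k j * t (j + i) ≤ (∑' j, k j) * T := fun i => by
    rw [← tsum_mul_right]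
    refine Summable.tsum_le_tsum (fun j => mul_le_mul_of_nonneg_left (hle _) (hk j)) ?_
      (hs.mul_right _)
    exact (hs.mul_right T).of_nonneg_of_le (fun j => mul_nonneg (hk j) (ht0 _))
      fun j => mul_le_mul_of_nonneg_left (hle _) (hk j)
  have hpos : 0 < 2 * k 0 := lt_of_le_of_lt (tsum_nonneg hk) h2
  -- Boundedness of `t` makes the supremum `T` finite; passing to it on both sides gives `2 k₀ T ≤ C
  -- + (∑ k) T`.
  have hTle : T ≤ (C + (∑' j, k j) * T) / (2 * k 0) :=
    ciSup_le fun i => (le_div_iff₀ hpos).2 (by nlinarith [h i, hS i])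
  rw [le_div_iff₀ hpos] at hTle
  nlinarith [hle i, hTle, h1, h2]

lemma circle_conj_mul_self (z : Circle) : conj (z : ℂ) * z = 1 := by
  rw [← Circle.coe_inv_eq_conj, ← Circle.coe_mul]; simp

lemma circle_mul_conj_self (z : Circle) : (z : ℂ) * conj (z : ℂ) = 1 := by
  rw [mul_comm, circle_conj_mul_self]

namespace ProjRep

variable {G H I J : Type*} [AddCommGroup G] [NormedAddCommGroup H] [InnerProductSpace ℂ H]
  (R : ProjRep G H)

lemma zero_left (y : G) : R.β 0 y = 1 := by
  have h := R.add_left 0 0 y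
  rwa [add_zero, left_eq_mul] at h

lemma zero_right (y : G) : R.β y 0 = 1 := by
  have h := R.add_right y 0 0
  rwa [add_zero, left_eq_mul] at h

lemma neg_left (x y : G) : R.β (-x) y = (R.β x y)⁻¹ := by
  have h := R.add_left (-x) x y
  rw [neg_add_cancel, zero_left] at h
  exact eq_inv_of_mul_eq_one_left h.symm

lemma neg_right (x y : G) : R.β x (-y) = (R.β x y)⁻¹ := by
  have h := R.add_right x (-y) y
  rw [neg_add_cancel, zero_right] at h
  exact eq_inv_of_mul_eq_one_left h.symm

lemma inner_op (x : G) (f g : H) : inner ℂ (R.op x f) (R.op x g) = inner ℂ f g :=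
  LinearIsometry.inner_map_map _ _ _

lemma inner_op_left (x : G) (f g : H) :
    inner ℂ (R.op x f) g = inner ℂ f ((R.β x x : ℂ) • R.op (-x) g) := by
  rw [← R.inner_op x f, map_smul, R.op_op, neg_right, add_neg_cancel, R.op_zero, smul_smul,
    Circle.coe_inv_eq_conj, circle_mul_conj_self, one_smul]

lemma inner_op_op (x y : G) (f g : H) :
    inner ℂ (R.op x (R.op y f)) g = conj (R.β x y : ℂ) * inner ℂ (R.op (x + y) f) g := by
  rw [R.op_op, inner_smul_left]

/-- The matrix coefficient `⟨φ, π_x φ⟩`. -/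
noncomputable def coeff (φ : H) (x : G) : ℂ := inner ℂ φ (R.op x φ)

lemma inner_op_self (φ : H) (x : G) : inner ℂ (R.op x φ) φ = conj (R.coeff φ x) := by
  rw [coeff, inner_conj_symm]

lemma coeff_neg (φ : H) (x : G) : R.coeff φ (-x) = conj (R.β x x : ℂ) * conj (R.coeff φ x) := by
  rw [← inner_op_self, inner_op_left, inner_smul_right, ← mul_assoc, circle_conj_mul_self, one_mul,
    coeff]

lemma inner_op_op_eq_coeff (φ : H) (x y : G) :
    inner ℂ (R.op x φ) (R.op y φ) = conj (R.β x (y - x) : ℂ) * R.coeff φ (y - x) := by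
  have h := R.op_op x (y - x) φ
  rw [add_sub_cancel] at h
  have h2 : R.op y φ = conj (R.β x (y - x) : ℂ) • R.op x (R.op (y - x) φ) := by
    rw [h, smul_smul, circle_conj_mul_self, one_smul]
  rw [h2, inner_smul_right, R.inner_op, coeff]

lemma coeff_zero (φ : H) : R.coeff φ 0 = ((‖φ‖ ^ 2 : ℝ) : ℂ) := by
  rw [coeff, R.op_zero, inner_self_eq_norm_sq_to_K]; norm_cast

lemma norm_coeff_zero (φ : H) : ‖R.coeff φ 0‖ = ‖φ‖ ^ 2 := by
  rw [coeff_zero, Complex.norm_real, Real.norm_of_nonneg (by positivity)]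

variable [CompleteSpace H]

/-- The operator `∑_j ⟨φ, π_{Z j} φ⟩ π_{Z j}^*`. -/
noncomputable def frame (φ : H) (Z : J → G) : H →L[ℂ] H :=
  ∑' j, R.coeff φ (Z j) • ContinuousLinearMap.adjoint (R.op (Z j)).toContinuousLinearMap

lemma norm_adjoint_op_le (x : G) :
    ‖ContinuousLinearMap.adjoint (R.op x).toContinuousLinearMap‖ ≤ 1 := by
  rw [LinearIsometryEquiv.norm_map]
  exact (R.op x).norm_toContinuousLinearMap_le

section
variable {φ : H} {Z : J → G} (hs : Summable fun j => ‖R.coeff φ (Z j)‖)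
include hs

lemma summable_norm_frame : Summable fun j =>
    ‖R.coeff φ (Z j) • ContinuousLinearMap.adjoint (R.op (Z j)).toContinuousLinearMap‖ :=
  hs.of_nonneg_of_le (fun _ => norm_nonneg _) fun j => by
    rw [norm_smul]
    exact mul_le_of_le_one_right (norm_nonneg _) (R.norm_adjoint_op_le _)

lemma hasSum_inner_frame (g f : H) :
    HasSum (fun j => R.coeff φ (Z j) * inner ℂ (R.op (Z j) g) f) (inner ℂ g (R.frame φ Z f)) := by
  have h := (R.summable_norm_frame hs).of_norm.hasSum
  have h2 := (innerSL ℂ g).hasSum ((ContinuousLinearMap.apply ℂ H f).hasSum h)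
  refine h2.congr_fun fun j => ?_
  simp [ContinuousLinearMap.adjoint_inner_right]

end

end ProjRep

lemma summable_mul_of_bounded {J : Type*} {K s : J → ℂ} {B : ℝ} (hs : Summable fun j => ‖K j‖)
    (hB : ∀ j, ‖s j‖ ≤ B) : Summable fun j => ‖K j * s j‖ :=
  (hs.mul_right B).of_nonneg_of_le (fun _ => norm_nonneg _) fun j => by
    rw [norm_mul]; exact mul_le_mul_of_nonneg_left (hB j) (norm_nonneg _)

/-- Uniqueness of bounded solutions: the maximum principle with `C = 0`. The unimodular factors `u`
absorb the cocycle, which does not affect norms. -/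
lemma eq_zero_of_diagonally_dominant {J : Type*} [AddCommGroup J] {K : J → ℂ}
    (hs : Summable fun j => ‖K j‖) (hlt : ∑' j, ‖K j‖ < 2 * ‖K 0‖) {u : J → J → ℂ}
    (hu : ∀ i j, ‖u i j‖ = 1) {s : J → ℂ} {B : ℝ} (hB : ∀ i, ‖s i‖ ≤ B)
    (h : ∀ i, ∑' j, K j * (u i j * s (j + i)) = 0) (i : J) : s i = 0 := by
  have key := le_of_diagonally_dominant (k := fun j => ‖K j‖) (fun _ => norm_nonneg _) hs
    (t := fun i => ‖s i‖) (fun _ => norm_nonneg _) hB (C := 0) (fun i => ?_) i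
  · rcases key with key | key
    · have : 0 < 2 * ‖K 0‖ - ∑' j, ‖K j‖ := by linarith
      have h3 : ‖s i‖ ≤ 0 := by
        by_contra! h0
        nlinarith
      exact norm_le_zero_iff.1 h3
    · linarith
  · have h1 := two_mul_norm_le_of_summable (f := fun j => K j * (u i j * s (j + i)))
      (summable_mul_of_bounded (B := B) hs fun j => by rw [norm_mul, hu, one_mul]; exact hB _) 0
    rw [h, norm_zero] at h1
    simp only [norm_mul, hu, one_mul, zero_add] at h1
    linarith

namespace ProjRep

variable {G H I J : Type*} [AddCommGroup G] [NormedAddCommGroup H] [InnerProductSpace ℂ H]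
  [AddCommGroup J] (R : ProjRep G H) [CompleteSpace H]
  {φ : H} {Z : J →+ G} (hs : Summable fun j => ‖R.coeff φ (Z j)‖)

include hs

/-- The term at `0` is `‖φ‖²` times the identity and the remaining terms have total norm less than
`‖φ‖²`, so a Neumann series inverts the operator. -/
lemma isUnit_frame (hlt : ∑' j, ‖R.coeff φ (Z j)‖ < 2 * ‖φ‖ ^ 2) : IsUnit (R.frame φ Z) := by
  classical
  have hsn := R.summable_norm_frame hs
  have h0 : ContinuousLinearMap.adjoint (R.op (Z 0)).toContinuousLinearMap = 1 := by
    have : (R.op (Z 0)).toContinuousLinearMap = 1 := by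
      ext f; simp [R.op_zero]
    rw [this, ← ContinuousLinearMap.star_eq_adjoint, star_one]
  have hZ0 : R.coeff φ (Z 0) = ((‖φ‖ ^ 2 : ℝ) : ℂ) := by rw [map_zero, coeff_zero]
  have e1 := hsn.of_norm.tsum_eq_add_tsum_ite 0
  have e2 := hs.tsum_eq_add_tsum_ite 0
  rw [h0, hZ0] at e1
  rw [hZ0, Complex.norm_real, Real.norm_of_nonneg (by positivity)] at e2
  have hpos : 0 < ‖φ‖ ^ 2 := by
    have : 0 ≤ ∑' j, ‖R.coeff φ (Z j)‖ := tsum_nonneg fun _ => norm_nonneg _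
    linarith
  have hb : ‖R.frame φ Z - ((‖φ‖ ^ 2 : ℝ) : ℂ) • (1 : H →L[ℂ] H)‖ < ‖φ‖ ^ 2 := by
    have hle : ∀ j, ‖if j = 0 then (0 : H →L[ℂ] H) else R.coeff φ (Z j) •
        ContinuousLinearMap.adjoint (R.op (Z j)).toContinuousLinearMap‖ ≤
        if j = 0 then 0 else ‖R.coeff φ (Z j)‖ := fun j => by
      split_ifs
      · simp
      · rw [norm_smul]
        exact mul_le_of_le_one_right (norm_nonneg _) (R.norm_adjoint_op_le _)
    have hsum : Summable fun j => if j = 0 then 0 else ‖R.coeff φ (Z j)‖ :=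
      hs.of_nonneg_of_le (fun j => by split_ifs <;> positivity) fun j => by
        split_ifs
        · positivity
        · rfl
    rw [frame, e1, add_sub_cancel_left]
    exact (tsum_of_norm_bounded hsum.hasSum hle).trans_lt (by linarith)
  set r : ℂ := ((‖φ‖ ^ 2 : ℝ) : ℂ) with hr
  have hr0 : r ≠ 0 := by rw [hr]; exact_mod_cast hpos.ne'
  have hnr : ‖r‖ = ‖φ‖ ^ 2 := by rw [hr, Complex.norm_real, Real.norm_of_nonneg hpos.le]
  have hu : IsUnit (1 - r⁻¹ • (r • (1 : H →L[ℂ] H) - R.frame φ Z)) := by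
    refine isUnit_one_sub_of_norm_lt_one ?_
    rw [norm_smul, norm_inv, hnr, norm_sub_rev, inv_mul_lt_one₀ hpos]
    exact hb
  rw [smul_sub, smul_smul, inv_mul_cancel₀ hr0, one_smul, sub_sub_cancel] at hu
  have := hu.smul (Units.mk0 r hr0)
  rwa [Units.smul_mk0, smul_smul, mul_inv_cancel₀ hr0, one_smul] at this

/-- The terms at `j` and `-j` are adjoint to each other: the phases in `coeff_neg` and
`inner_op_left` cancel. -/
lemma inner_frame_left (f g : H) : inner ℂ (R.frame φ Z f) g = inner ℂ f (R.frame φ Z g) := by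
  have h1 := Complex.hasSum_conj'.2 (R.hasSum_inner_frame hs g f)
  rw [inner_conj_symm] at h1
  have h2 := R.hasSum_inner_frame hs f g
  rw [← (Equiv.neg J).hasSum_iff] at h2
  refine h1.unique (h2.congr_fun fun j => ?_)
  simp only [Function.comp_apply, Equiv.neg_apply, map_neg, map_mul, inner_conj_symm]
  rw [coeff_neg, inner_op_left, neg_left, neg_right, inv_inv, inner_smul_right, neg_neg]
  linear_combination (-conj (R.coeff φ (Z j)) * inner ℂ f (R.op (Z j) g)) *
    circle_mul_conj_self (R.β (Z j) (Z j))

/-- The symmetry `hw` says that `π_w` commutes with each `π_{Z j}`; this is the purpose of taking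
the sum over `D^⊥`. -/
lemma frame_op_comm {w : G} (hw : ∀ j, R.β w (Z j) = R.β (Z j) w) (f : H) :
    R.frame φ Z (R.op w f) = R.op w (R.frame φ Z f) := by
  refine ext_inner_left ℂ fun g => ?_
  obtain ⟨g, rfl⟩ : ∃ g', R.op w g' = g := by
    refine ⟨(R.β w w : ℂ) • R.op (-w) g, ?_⟩
    rw [map_smul, R.op_op, neg_right, add_neg_cancel, R.op_zero, smul_smul,
      Circle.coe_inv_eq_conj, circle_mul_conj_self, one_smul]
  rw [R.inner_op]
  refine (R.hasSum_inner_frame hs _ _).unique ((R.hasSum_inner_frame hs g f).congr_fun fun j => ?_)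
  rw [← R.inner_op w (R.op (Z j) g), R.op_op, R.op_op, hw, add_comm w]

lemma hasSum_inner_op_frame (x : G) (f : H) :
    HasSum (fun j => R.coeff φ (Z j) * (conj (R.β (Z j) x : ℂ) * inner ℂ (R.op (Z j + x) φ) f))
      (inner ℂ (R.op x φ) (R.frame φ Z f)) :=
  (R.hasSum_inner_frame hs (R.op x φ) f).congr_fun fun j => by rw [inner_op_op]

/-! ### The dual window and its coefficients -/

section dual

variable (hlt : ∑' j, ‖R.coeff φ (Z j)‖ < 2 * ‖φ‖ ^ 2) {ψ : H} (hψ : R.frame φ Z ψ = φ)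
include hlt hψ

omit hlt in
-- The equation `a ψ = φ` tested against `π_x φ`. With `x` replaced by `Z i + x`, it is a
-- convolution system along the coset of `x`, with kernel `coeff φ ∘ Z`.
lemma inner_op_dual_eq (x : G) :
    ∑' j, R.coeff φ (Z j) * (conj (R.β (Z j) x : ℂ) * inner ℂ (R.op (Z j + x) φ) ψ) =
      conj (R.coeff φ x) := by
  rw [(R.hasSum_inner_op_frame hs x ψ).tsum_eq, hψ, inner_op_self]

omit [CompleteSpace H] hs hlt hψ in
lemma norm_inner_op_le (x : G) (f g : H) : ‖inner ℂ (R.op x f) g‖ ≤ ‖f‖ * ‖g‖ :=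
  (norm_inner_le_norm _ _).trans (by rw [LinearIsometry.norm_map])

/-- The coefficients of the dual window are absolutely summable along the lattice. -/
lemma sum_norm_dual_le (W : I → G) {C : ℝ}
    (hC : ∀ j, ∀ F : Finset I, ∑ i ∈ F, ‖R.coeff φ (W i + Z j)‖ ≤ C) (F : Finset I) :
    ∑ i ∈ F, ‖inner ℂ (R.op (W i) φ) ψ‖ ≤ C / (2 * ‖φ‖ ^ 2 - ∑' j, ‖R.coeff φ (Z j)‖) := by
  have hZ0 : ‖R.coeff φ (Z 0)‖ = ‖φ‖ ^ 2 := by rw [map_zero, norm_coeff_zero]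
  have hbd : ∀ x, ‖inner ℂ (R.op x φ) ψ‖ ≤ ‖φ‖ * ‖ψ‖ := fun x => R.norm_inner_op_le x φ ψ
  have hsum : ∀ x, Summable fun j => ‖R.coeff φ (Z j)‖ * ‖inner ℂ (R.op (Z j + x) φ) ψ‖ :=
    fun x => (summable_mul_of_bounded (s := fun j => inner ℂ (R.op (Z j + x) φ) ψ) hs
      fun j => hbd _).congr fun j => norm_mul _ _
  have hpt : ∀ x, 2 * ‖φ‖ ^ 2 * ‖inner ℂ (R.op x φ) ψ‖ ≤ ‖R.coeff φ x‖ +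
      ∑' j, ‖R.coeff φ (Z j)‖ * ‖inner ℂ (R.op (Z j + x) φ) ψ‖ := fun x => by
    have h1 := two_mul_norm_le_of_summable (f := fun j => R.coeff φ (Z j) *
      (conj (R.β (Z j) x : ℂ) * inner ℂ (R.op (Z j + x) φ) ψ)) ((hsum x).congr fun j => by
        rw [norm_mul, norm_mul, RCLike.norm_conj, Circle.norm_coe, one_mul]) 0
    rw [R.inner_op_dual_eq hs hψ x] at h1
    simp only [norm_mul, RCLike.norm_conj, Circle.norm_coe, one_mul, hZ0] at h1
    rw [map_zero, zero_add] at h1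
    linarith
  -- Summing over a finite `F` first keeps `t` bounded, as the maximum principle requires; the
  -- resulting bound does not depend on `F`.
  have key := le_of_diagonally_dominant (k := fun j => ‖R.coeff φ (Z j)‖) (fun _ => norm_nonneg _) hs
    (t := fun j => ∑ i ∈ F, ‖inner ℂ (R.op (W i + Z j) φ) ψ‖)
    (fun _ => Finset.sum_nonneg fun _ _ => norm_nonneg _)
    (B := ∑ _i ∈ F, ‖φ‖ * ‖ψ‖) (fun j => Finset.sum_le_sum fun i _ => hbd _) (C := C) (fun j => ?_) 0
  · simp only [hZ0] at key
    simp only [map_zero, add_zero] at key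
    rcases key with key | key
    · rw [le_div_iff₀ (by linarith), mul_comm]; exact key
    · linarith
  · have h2 := Finset.sum_le_sum fun i (_ : i ∈ F) => hpt (W i + Z j)
    rw [← Finset.mul_sum, Finset.sum_add_distrib,
      ← Summable.tsum_finsetSum fun i _ => hsum (W i + Z j)] at h2
    simp only [hZ0]
    refine h2.trans (add_le_add (hC j F) (le_of_eq (tsum_congr fun l => ?_)))
    rw [← Finset.mul_sum]
    simp only [map_add, add_left_comm]

/-- Biorthogonality of the window and the dual window. -/
lemma inner_dual_self : inner ℂ φ ψ = 1 := by
  classical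
  have hZ0 : ‖R.coeff φ (Z 0)‖ = ‖φ‖ ^ 2 := by rw [map_zero, norm_coeff_zero]
  -- The sequence `δ_{i,0}` solves the same system as `⟨π_{Z i} φ, ψ⟩`, so the two agree (Wexler–Raz
  -- biorthogonality).
  have key := eq_zero_of_diagonally_dominant hs (by rwa [hZ0])
    (u := fun i j => conj (R.β (Z j) (Z i) : ℂ)) (fun i j => by rw [RCLike.norm_conj, Circle.norm_coe])
    (s := fun i => inner ℂ (R.op (Z i) φ) ψ - if i = 0 then 1 else 0) (B := ‖φ‖ * ‖ψ‖ + 1)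
    (fun i => (norm_sub_le _ _).trans (add_le_add (R.norm_inner_op_le _ _ _)
      (by split_ifs <;> simp))) (fun i => ?_) 0
  · simpa [sub_eq_zero, R.op_zero] using key
  · have h1 := (R.hasSum_inner_op_frame hs (Z i) ψ)
    rw [hψ, inner_op_self] at h1
    -- Convolving with `δ_0` leaves only `j = -i`, and `coeff_neg` turns that term into the
    -- right-hand side `conj (coeff φ (Z i))`.
    have h2 := hasSum_ite_eq (-i) (R.coeff φ (Z (-i)) * conj (R.β (Z (-i)) (Z i) : ℂ))
    have h3 := h1.sub h2
    have e : conj (R.coeff φ (Z i)) - R.coeff φ (Z (-i)) * conj (R.β (Z (-i)) (Z i) : ℂ) = 0 := by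
      rw [map_neg, coeff_neg, neg_left, Circle.coe_inv_eq_conj, Complex.conj_conj]
      linear_combination (-conj (R.coeff φ (Z i))) * circle_conj_mul_self (R.β (Z i) (Z i))
    rw [e] at h3
    refine (tsum_congr fun j => ?_).trans h3.tsum_eq
    by_cases hj : j = -i
    · subst hj; simp [mul_sub]
    · simp [hj, add_eq_zero_iff_eq_neg, map_add]

/-- Symmetries of the coefficients of the window pass to the dual window. -/
lemma inner_dual_symm (σ : G →+ G) (τ : J ≃ J) (hτ : ∀ j, σ (Z j) = Z (τ j))
    (hβ : ∀ x y, R.β (σ x) (σ y) = (R.β y x)⁻¹)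
    (hK : ∀ x, R.coeff φ (σ x) = (R.β x x : ℂ) * R.coeff φ x) (x : G) :
    inner ℂ (R.op (σ x) φ) ψ = conj (R.β x x : ℂ) * inner ℂ (R.op x φ) ψ := by
  have hZ0 : ‖R.coeff φ (Z 0)‖ = ‖φ‖ ^ 2 := by rw [map_zero, norm_coeff_zero]
  have hmul : ∀ y, (R.β y y : ℂ) * inner ℂ (R.op (σ y) φ) ψ - inner ℂ (R.op y φ) ψ =
      (R.β y y : ℂ) * (inner ℂ (R.op (σ y) φ) ψ - conj (R.β y y : ℂ) * inner ℂ (R.op y φ) ψ) :=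
    fun y => by linear_combination inner ℂ (R.op y φ) ψ * circle_mul_conj_self (R.β y y)
  have key := eq_zero_of_diagonally_dominant hs (by rwa [hZ0])
    (u := fun i j => conj (R.β (Z j) (Z i + x) : ℂ)) (fun i j => by rw [RCLike.norm_conj, Circle.norm_coe])
    (s := fun i => (R.β (Z i + x) (Z i + x) : ℂ) * inner ℂ (R.op (σ (Z i + x)) φ) ψ -
      inner ℂ (R.op (Z i + x) φ) ψ) (B := ‖φ‖ * ‖ψ‖ + ‖φ‖ * ‖ψ‖)
    (fun i => (norm_sub_le _ _).trans (add_le_add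
      (by rw [norm_mul, Circle.norm_coe, one_mul]; exact R.norm_inner_op_le _ _ _)
      (R.norm_inner_op_le _ _ _))) (fun i => ?_) 0
  · rw [map_zero, zero_add, hmul, mul_eq_zero, sub_eq_zero] at key
    exact key.resolve_left (Circle.coe_ne_zero _)
  · set y := Z i + x with hy
    have h1 := R.hasSum_inner_op_frame hs y ψ
    have h2 := R.hasSum_inner_op_frame hs (σ y) ψ
    rw [hψ, inner_op_self] at h1 h2
    -- Reindexed by `τ` and multiplied by `β(y, y)`, the equation at `σ y` has the same kernel and
    -- right-hand side as the equation at `y`. Their difference is homogeneous.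
    rw [← τ.hasSum_iff] at h2
    have h3 := (h2.mul_left (R.β y y : ℂ)).sub h1
    have e : (R.β y y : ℂ) * conj (R.coeff φ (σ y)) - conj (R.coeff φ y) = 0 := by
      rw [hK, map_mul]
      linear_combination (conj (R.coeff φ y)) * circle_mul_conj_self (R.β y y)
    rw [e] at h3
    refine (tsum_congr fun j => ?_).trans h3.tsum_eq
    have hj : Z (j + i) + x = Z j + y := by rw [map_add, hy, add_assoc]
    simp only [Function.comp_apply]
    rw [hj, ← hτ, hβ, hK, Circle.coe_inv_eq_conj, Complex.conj_conj, R.add_left (Z j) y,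
      R.add_right (Z j) (Z j) y, R.add_right y (Z j) y, map_add]
    push_cast
    linear_combination (R.coeff φ (Z j) * R.β (Z j) (Z j) * R.β y (Z j) * R.β y y *
      inner ℂ (R.op (σ (Z j) + σ y) φ) ψ) * circle_conj_mul_self (R.β (Z j) y)

/-- The dual window lies in the closed span of the translates of the window. -/
lemma inner_op_dual_eq_zero {v : H} (hv : ∀ x, inner ℂ v (R.op x φ) = 0) (x : G) :
    inner ℂ v (R.op x ψ) = 0 := by
  have hZ0 : ‖R.coeff φ (Z 0)‖ = ‖φ‖ ^ 2 := by rw [map_zero, norm_coeff_zero]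
  have hv' : ∀ y, inner ℂ (R.op y v) φ = 0 := fun y => by
    rw [inner_op_left, inner_smul_right, hv, mul_zero]
  -- The base point is `-x` because `⟨π_{-x} v, ψ⟩` is `⟨v, π_x ψ⟩` up to a phase. The system is
  -- homogeneous since `v` is orthogonal to every translate of `φ`.
  have key := eq_zero_of_diagonally_dominant hs (by rwa [hZ0])
    (u := fun i j => conj (R.β (Z j) (Z i - x) : ℂ)) (fun i j => by rw [RCLike.norm_conj, Circle.norm_coe])
    (s := fun i => inner ℂ (R.op (Z i - x) v) ψ) (B := ‖v‖ * ‖ψ‖)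
    (fun i => R.norm_inner_op_le _ _ _) (fun i => ?_) 0
  · rw [inner_op_left, inner_smul_right, mul_eq_zero] at key
    simpa using key.resolve_left (Circle.coe_ne_zero _)
  · have h1 := R.hasSum_inner_frame hs (R.op (Z i - x) v) ψ
    rw [hψ, hv'] at h1
    refine (tsum_congr fun j => ?_).trans h1.tsum_eq
    rw [inner_op_op, map_add, add_sub_assoc]

end dual

end ProjRep

/-! ### Idempotence from Janssen's identity -/

namespace ProjRep

variable {G H I J : Type*} [AddCommGroup G] [NormedAddCommGroup H] [InnerProductSpace ℂ H]
  [AddCommGroup I] [AddCommGroup J] (R : ProjRep G H)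

lemma norm_inner_op_op (φ : H) (x y : G) :
    ‖inner ℂ (R.op x φ) (R.op y φ)‖ = ‖R.coeff φ (x - y)‖ := by
  rw [inner_op_op_eq_coeff, ← neg_sub x y, coeff_neg, norm_mul, norm_mul, RCLike.norm_conj,
    RCLike.norm_conj, RCLike.norm_conj, Circle.norm_coe, Circle.norm_coe, one_mul, one_mul]

variable [CompleteSpace H]
  {φ : H} {Z : J →+ G} (hs : Summable fun j => ‖R.coeff φ (Z j)‖) {ψ : H}
  (hψ : R.frame φ Z ψ = φ) {W : I →+ G} (hW : ∀ i j, R.β (W i) (Z j) = R.β (Z j) (W i))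
include hs hψ hW

/-- Write the left-hand `φ` as `a ψ` and move the self-adjoint `a`, which commutes with both
operators, to the other side. -/
lemma inner_op_window_dual (i l : I) :
    inner ℂ (R.op (W i) φ) (R.op (W l) ψ) = inner ℂ (R.op (W i) ψ) (R.op (W l) φ) := by
  conv_lhs => rw [← hψ, ← R.frame_op_comm hs (hW i), inner_frame_left R hs,
    R.frame_op_comm hs (hW l), hψ]

lemma inner_dual_neg (i : I) :
    inner ℂ (R.op (W (-i)) φ) ψ = (R.β (W i) (W i) : ℂ) * conj (inner ℂ (R.op (W i) φ) ψ) := by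
  have h := R.inner_op_window_dual hs hψ hW i 0
  rw [map_zero, R.op_zero, R.op_zero] at h
  rw [h, inner_conj_symm, inner_op_left, map_neg, neg_neg, neg_left, neg_right, inv_inv,
    inner_smul_right]

omit hψ hW in
-- The expansion `φ = ∑ c ⟨π_w φ, ψ⟩ π_w φ` tested against `π_x ψ`. The hypothesis `hJ` is Janssen's
-- identity on translates of `φ` only; `inner_op_dual_eq_zero` is applied twice to replace a
-- translate of `φ` by one of `ψ`.
lemma hasSum_inner_of_janssen (hlt : ∑' j, ‖R.coeff φ (Z j)‖ < 2 * ‖φ‖ ^ 2)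
    (hψ : R.frame φ Z ψ = φ) {c : ℂ} (hc : conj c = c)
    (hsum : ∀ x, Summable fun i => ‖R.coeff φ (W i - x)‖)
    (hκ : Summable fun i => ‖inner ℂ (R.op (W i) φ) ψ‖)
    (hJ : ∀ x y, ∑' i, c * (inner ℂ (R.op y φ) (R.op (W i) φ) *
      inner ℂ (R.op (W i) φ) (R.op x φ)) =
      ∑' j, R.coeff φ (Z j) * inner ℂ (R.op (Z j) (R.op y φ)) (R.op x φ)) (x : G) :
    HasSum (fun i => c * inner ℂ (R.op (W i) φ) ψ * inner ℂ (R.op x ψ) (R.op (W i) φ))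
      (inner ℂ (R.op x ψ) φ) := by
  have hnorm : ∀ {f : I → ℂ}, (Summable fun i => ‖f i‖) →
      Summable fun i => (c * f i) • R.op (W i) φ := fun {f} hf => by
    refine Summable.of_norm (((hf.mul_left ‖c‖).mul_right ‖φ‖).congr fun i => ?_)
    rw [norm_smul, norm_mul, LinearIsometry.norm_map]
  have step : ∀ y, ∑' i, c * (inner ℂ (R.op y φ) (R.op (W i) φ) * inner ℂ (R.op (W i) φ) ψ) =
      inner ℂ (R.op y φ) φ := fun y => by
    have h1 := (hnorm (f := fun i => inner ℂ (R.op (W i) φ) (R.op y φ))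
      ((hsum y).congr fun i => (R.norm_inner_op_op φ _ _).symm)).hasSum
    set v := ∑' i, (c * inner ℂ (R.op (W i) φ) (R.op y φ)) • R.op (W i) φ with hv
    have hinner : ∀ f, HasSum (fun i => c * (inner ℂ (R.op y φ) (R.op (W i) φ) *
        inner ℂ (R.op (W i) φ) f)) (inner ℂ v f) := fun f => by
      have h2 := Complex.hasSum_conj'.2 ((innerSL ℂ f).hasSum h1)
      rw [innerSL_apply_apply, inner_conj_symm] at h2
      refine h2.congr_fun fun i => ?_
      rw [innerSL_apply_apply, inner_smul_right, map_mul, map_mul, inner_conj_symm,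
        inner_conj_symm, hc, mul_assoc]
    -- By `hJ` this difference is orthogonal to all translates of `φ`, hence to `ψ`; then `⟨a π_y φ,
    -- ψ⟩ = ⟨π_y φ, φ⟩`.
    have hz := R.inner_op_dual_eq_zero hs hlt hψ (v := v - R.frame φ Z (R.op y φ)) (fun x => by
      rw [inner_sub_left, sub_eq_zero, ← (hinner _).tsum_eq, hJ, inner_frame_left R hs]
      exact (R.hasSum_inner_frame hs _ _).tsum_eq) 0
    rw [R.op_zero, inner_sub_left, sub_eq_zero, inner_frame_left R hs, hψ] at hz
    rw [(hinner ψ).tsum_eq, hz]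
  have h1 := (hnorm hκ).hasSum
  set v := ∑' i, (c * inner ℂ (R.op (W i) φ) ψ) • R.op (W i) φ with hv
  have hinner : ∀ f, HasSum (fun i => c * inner ℂ (R.op (W i) φ) ψ * inner ℂ f (R.op (W i) φ))
      (inner ℂ f v) := fun f => by
    refine ((innerSL ℂ f).hasSum h1).congr_fun fun i => ?_
    rw [innerSL_apply_apply, inner_smul_right]
  have hz := R.inner_op_dual_eq_zero hs hlt hψ (v := v - φ) (fun y => by
    rw [← inner_conj_symm, inner_sub_right, ← step y, ← (hinner _).tsum_eq, sub_eq_zero.2, map_zero]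
    exact tsum_congr fun i => by ring) x
  rw [← inner_conj_symm, inner_sub_right, map_eq_zero, sub_eq_zero] at hz
  rw [← hz]
  exact hinner _

/-- The coefficients of the dual window are idempotent for twisted convolution. -/
lemma tsum_twisted_dual (hlt : ∑' j, ‖R.coeff φ (Z j)‖ < 2 * ‖φ‖ ^ 2) {c : ℂ} (hc : conj c = c)
    (hsum : ∀ x, Summable fun i => ‖R.coeff φ (W i - x)‖)
    (hκ : Summable fun i => ‖inner ℂ (R.op (W i) φ) ψ‖)
    (hJ : ∀ x y, ∑' i, c * (inner ℂ (R.op y φ) (R.op (W i) φ) *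
      inner ℂ (R.op (W i) φ) (R.op x φ)) =
      ∑' j, R.coeff φ (Z j) * inner ℂ (R.op (Z j) (R.op y φ)) (R.op x φ)) (i : I) :
    ∑' l, c * inner ℂ (R.op (W l) φ) ψ * ((R.β (W l) (W (i - l)) : ℂ) *
      inner ℂ (R.op (W (i - l)) φ) ψ) = inner ℂ (R.op (W i) φ) ψ := by
  -- Rewrite `⟨π_i φ, ψ⟩` as `⟨π_i ψ, φ⟩`, expand `φ`, and exchange `φ` and `ψ` back in each term;
  -- the leftover phase is the twist.
  have h0 := R.inner_op_window_dual hs hψ hW i 0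
  rw [map_zero, R.op_zero, R.op_zero] at h0
  rw [h0, ← (R.hasSum_inner_of_janssen hs hlt hψ hc hsum hκ hJ (W i)).tsum_eq]
  refine tsum_congr fun l => ?_
  rw [← R.inner_op_window_dual hs hψ hW, ← R.inner_op (W l) (R.op (W (i - l)) φ), inner_op_op,
    ← map_add, add_sub_cancel, ← mul_assoc (R.β (W l) (W (i - l)) : ℂ), circle_mul_conj_self,
    one_mul]

end ProjRep

/-! ### Projections from twisted convolution idempotents -/

lemma zpow_mul_zpow_of_commutator {Γ : Type*} [Group Γ] {a b z : Γ} (ha : Commute z a)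
    (hb : Commute z b) (h : a * b = z * (b * a)) (m n : ℤ) :
    a ^ m * b ^ n = z ^ (m * n) * (b ^ n * a ^ m) := by
  have h1 : a * b ^ n * a⁻¹ = z ^ n * b ^ n := by
    rw [← conj_zpow, ← hb.mul_zpow, h]; group
  have h2 : b ^ (-n) * a * (b ^ (-n))⁻¹ = z ^ n * a := by
    have h3 : a * b ^ n = z ^ n * b ^ n * a := by rw [← h1]; group
    rw [zpow_neg, inv_inv, mul_assoc, h3, ← mul_assoc, ← mul_assoc, ((hb.zpow_zpow n n).inv_right).eq.symm]
    group
  have h4 : b ^ (-n) * a ^ m * (b ^ (-n))⁻¹ = z ^ (m * n) * a ^ m := by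
    rw [← conj_zpow, h2, (ha.zpow_left n).mul_zpow, ← zpow_mul, mul_comm n m]
  have h5 : a ^ m * b ^ n = b ^ n * (b ^ (-n) * a ^ m * (b ^ (-n))⁻¹) := by group
  rw [h5, h4, ← mul_assoc, (hb.zpow_zpow (m * n) n).eq.symm, mul_assoc]

namespace TwistedTorus

variable {A : Type*} [CStarAlgebra A] (U V : unitary A)

/-- The monomial `v^n u^m`. -/
def mon (w : ℤ × ℤ) : A := ((V ^ w.2 * U ^ w.1 : unitary A) : A)

/-- A scalar of modulus one as a unitary element. -/
noncomputable def scalar (c : Circle) : unitary A :=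
  ⟨algebraMap ℂ A c, by
    rw [Unitary.mem_iff, ← algebraMap_star_comm, ← map_mul, ← map_mul]
    exact ⟨by rw [← map_one (algebraMap ℂ A)]; congr 1; exact circle_conj_mul_self c,
      by rw [← map_one (algebraMap ℂ A)]; congr 1; exact circle_mul_conj_self c⟩⟩

lemma coe_scalar (c : Circle) : ((scalar c : unitary A) : A) = algebraMap ℂ A c := rfl

lemma scalar_commute (c : Circle) (W : unitary A) : Commute (scalar c) W :=
  Subtype.ext (Algebra.commutes _ _)

lemma scalar_mul (c d : Circle) : (scalar (c * d) : unitary A) = scalar c * scalar d :=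
  Subtype.ext (by simp [coe_scalar])

lemma scalar_zpow (c : Circle) (n : ℤ) : (scalar (c ^ n) : unitary A) = scalar c ^ n :=
  map_zpow (⟨⟨scalar, Subtype.ext (by simp [coe_scalar])⟩, scalar_mul⟩ : Circle →* unitary A) c n

lemma norm_mon_le (w : ℤ × ℤ) : ‖mon U V w‖ ≤ 1 := by
  rcases subsingleton_or_nontrivial A with h | h
  · rw [Subsingleton.elim (mon U V w) 0, norm_zero]; exact zero_le_one
  · exact (CStarRing.norm_of_mem_unitary (Subtype.mem _)).le

variable {U V} {c : Circle} (hUV : (U : A) * V = (c : ℂ) • ((V : A) * U))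

include hUV

lemma zpow_mul_zpow (m n : ℤ) : U ^ m * V ^ n = scalar (c ^ (m * n)) * (V ^ n * U ^ m) := by
  rw [scalar_zpow]
  refine zpow_mul_zpow_of_commutator (scalar_commute _ _) (scalar_commute _ _) ?_ m n
  refine Subtype.ext (hUV.trans ?_)
  simp [coe_scalar, Algebra.smul_def]

/-- Placing `v` before `u` gives the cocycle `c^(w.1 * z.2)`, the same shape as the Heisenberg
bicharacter on `D` in `bichar_grid`. -/
lemma mon_mul (w z : ℤ × ℤ) :
    mon U V w * mon U V z = ((c ^ (w.1 * z.2) : Circle) : ℂ) • mon U V (w + z) := by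
  have : V ^ w.2 * U ^ w.1 * (V ^ z.2 * U ^ z.1) =
      scalar (c ^ (w.1 * z.2)) * (V ^ (w + z).2 * U ^ (w + z).1) := by
    rw [mul_assoc, ← mul_assoc (U ^ w.1), zpow_mul_zpow hUV, Prod.fst_add, Prod.snd_add, zpow_add,
      zpow_add, ← mul_assoc (V ^ w.2), ← mul_assoc (V ^ w.2), ← (scalar_commute _ (V ^ w.2)).eq]
    simp only [mul_assoc]
  rw [mon, mon, ← Submonoid.coe_mul, this, Submonoid.coe_mul, coe_scalar, Algebra.smul_def, mon]

lemma star_mon (w : ℤ × ℤ) :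
    star (mon U V w) = ((c ^ (w.1 * w.2) : Circle) : ℂ) • mon U V (-w) := by
  have : (V ^ w.2 * U ^ w.1)⁻¹ = scalar (c ^ (w.1 * w.2)) * (V ^ (-w).2 * U ^ (-w).1) := by
    rw [mul_inv_rev, ← zpow_neg, ← zpow_neg, zpow_mul_zpow hUV, neg_mul_neg]
    rfl
  rw [mon, mon, ← Unitary.coe_star, Unitary.star_eq_inv, this, Submonoid.coe_mul, coe_scalar,
    Algebra.smul_def]

lemma map_mon (s : A →⋆ₐ[ℂ] A) (hU : s U = V) (hV : s V = star (U : A)) (w : ℤ × ℤ) :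
    s (mon U V w) = conj ((c ^ (w.1 * w.2) : Circle) : ℂ) • mon U V (-w.2, w.1) := by
  let t : A →⋆* A := ⟨(s : A →* A), fun a => map_star s a⟩
  have h1 : Unitary.map t U = V := Subtype.ext hU
  have h2 : Unitary.map t V = U⁻¹ := Subtype.ext hV
  have h3 : s (mon U V w) = ((Unitary.map t (V ^ w.2 * U ^ w.1) : unitary A) : A) := rfl
  rw [h3, map_mul, map_zpow, map_zpow, h1, h2, inv_zpow', zpow_mul_zpow hUV, neg_mul, zpow_neg,
    Submonoid.coe_mul, coe_scalar, Circle.coe_inv_eq_conj, Algebra.smul_def, mul_comm w.2, mon]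

omit hUV

lemma summable_mon {E : ℤ × ℤ → ℂ} (hE : Summable fun w => ‖E w‖) :
    Summable fun w => ‖E w • mon U V w‖ :=
  hE.of_nonneg_of_le (fun _ => norm_nonneg _) fun w => by
    rw [norm_smul]
    exact mul_le_of_le_one_right (norm_nonneg _) (norm_mon_le U V w)

lemma tsum_mon_mem (S : StarSubalgebra ℂ A) (hS : IsClosed (S : Set A)) (hU : (U : A) ∈ S)
    (hV : (V : A) ∈ S) (E : ℤ × ℤ → ℂ) : ∑' w, E w • mon U V w ∈ S := by
  have hz : ∀ W : unitary A, (W : A) ∈ S → ∀ n : ℤ, ((W ^ n : unitary A) : A) ∈ S := by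
    intro W hW n
    cases n with
    | ofNat n => simpa using pow_mem hW n
    | negSucc n =>
      rw [zpow_negSucc, ← Unitary.star_eq_inv, Unitary.coe_star]
      exact star_mem (by simpa using pow_mem hW (n + 1))
  refine tsum_mem hS fun w => ?_
  exact S.toSubalgebra.smul_mem (mul_mem (hz _ hV _) (hz _ hU _)) _

lemma map_tsum_mon_eq {E : ℤ × ℤ → ℂ} (hE : Summable fun w => ‖E w‖) (L : A →L[ℂ] ℂ)
    (hL : ∀ w, L (mon U V w) = if w = 0 then 1 else 0) : L (∑' w, E w • mon U V w) = E 0 := by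
  have h := L.hasSum (summable_mon (U := U) (V := V) hE).of_norm.hasSum
  have h2 : ∀ w, L (E w • mon U V w) = if w = 0 then E 0 else 0 := fun w => by
    rw [map_smul, hL]
    split_ifs with hw <;> simp [hw]
  simp_rw [h2] at h
  exact h.unique (hasSum_ite_eq 0 (E 0))

include hUV

lemma isStarProjection_tsum_mon {E : ℤ × ℤ → ℂ} (hE : Summable fun w => ‖E w‖)
    (hmul : ∀ w, ∑' l, E l * (((c ^ (l.1 * (w - l).2) : Circle) : ℂ) * E (w - l)) = E w)
    (hstar : ∀ w, E (-w) = ((c ^ (w.1 * w.2) : Circle) : ℂ) * conj (E w)) :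
    IsStarProjection (∑' w, E w • mon U V w) := by
  have hs := summable_mon (U := U) (V := V) hE
  constructor
  · rw [IsIdempotentElem, tsum_mul_tsum_of_summable_norm hs hs]
    -- Group the double sum by total degree `w`, so that the inner sum is the twisted convolution at
    -- `w`.
    let e : (ℤ × ℤ) × (ℤ × ℤ) ≃ (ℤ × ℤ) × (ℤ × ℤ) :=
      { toFun := fun x => (x.2, x.1 - x.2)
        invFun := fun x => (x.1 + x.2, x.1)
        left_inv := fun x => by simp
        right_inv := fun x => by simp }
    have hs2 := summable_mul_of_summable_norm hs hs
    rw [← e.tsum_eq (fun x => E x.1 • mon U V x.1 * E x.2 • mon U V x.2)]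
    refine (Summable.tsum_prod (e.summable_iff.2 hs2)).trans ?_
    refine tsum_congr fun w => ?_
    rw [← hmul w]
    have hterm : ∀ l, E l • mon U V l * E (w - l) • mon U V (w - l) =
        (E l * (((c ^ (l.1 * (w - l).2) : Circle) : ℂ) * E (w - l))) • mon U V w := fun l => by
      rw [smul_mul_smul_comm, mon_mul hUV, add_sub_cancel, smul_smul]
      ring_nf
    change ∑' l, E l • mon U V l * E (w - l) • mon U V (w - l) = _
    simp_rw [hterm]
    have h3 : Summable fun l => ‖E l * (((c ^ (l.1 * (w - l).2) : Circle) : ℂ) * E (w - l))‖ := by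
      refine summable_mul_of_bounded (K := E) (B := ∑' w, ‖E w‖)
        (s := fun l => ((c ^ (l.1 * (w - l).2) : Circle) : ℂ) * E (w - l)) hE fun l => ?_
      rw [norm_mul, Circle.norm_coe, one_mul]
      exact hE.le_tsum (w - l) fun _ _ => norm_nonneg _
    exact Summable.tsum_smul_const h3.of_norm _
  · rw [IsSelfAdjoint, tsum_star, ← (Equiv.neg (ℤ × ℤ)).tsum_eq]
    refine tsum_congr fun w => ?_
    rw [Equiv.neg_apply, star_smul, star_mon hUV, neg_neg, hstar, smul_smul]
    congr 1
    simp only [RCLike.star_def, map_mul, Complex.conj_conj, Prod.fst_neg, Prod.snd_neg, neg_mul_neg]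
    linear_combination E w * circle_conj_mul_self (c ^ (w.1 * w.2))

lemma map_tsum_mon_fixed {E : ℤ × ℤ → ℂ} (hE : Summable fun w => ‖E w‖)
    (hσ : ∀ w : ℤ × ℤ, E (-w.2, w.1) = conj ((c ^ (w.1 * w.2) : Circle) : ℂ) * E w)
    (s : A →⋆ₐ[ℂ] A) (hs : Continuous s) (hU : s U = V) (hV : s V = star (U : A)) :
    s (∑' w, E w • mon U V w) = ∑' w, E w • mon U V w := by
  let e : ℤ × ℤ ≃ ℤ × ℤ :=
    { toFun := fun w => (-w.2, w.1)
      invFun := fun w => (w.2, -w.1)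
      left_inv := fun w => by simp
      right_inv := fun w => by simp }
  have h1 := (summable_mon (U := U) (V := V) hE).of_norm.hasSum
  have h2 := h1.map s hs
  rw [← e.hasSum_iff] at h1
  refine h2.unique (h1.congr_fun fun w => ?_)
  change s (E w • mon U V w) = E (-w.2, w.1) • mon U V (-w.2, w.1)
  rw [map_smul, map_mon hUV s hU hV, hσ, smul_smul, mul_comm]

end TwistedTorus

/-! ### From invariant idempotents to projections in the fixed point algebra -/

namespace RotationAlgebra

/-- The generator `u` as a unitary of the ambient algebra. -/
noncomputable def uUnitary (α : ℝ) : unitary (Ambient α) :=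
  ⟨uAmb α, by
    rw [Unitary.mem_iff]
    constructor <;> refine Ambient.ext fun r => ?_
    · rw [map_mul, map_star, map_one, eval_u]; exact Unitary.coe_star_mul_self r.U
    · rw [map_mul, map_star, map_one, eval_u]; exact Unitary.coe_mul_star_self r.U⟩

/-- The generator `v` as a unitary of the ambient algebra. -/
noncomputable def vUnitary (α : ℝ) : unitary (Ambient α) :=
  ⟨vAmb α, by
    rw [Unitary.mem_iff]
    constructor <;> refine Ambient.ext fun r => ?_
    · rw [map_mul, map_star, map_one, eval_v]; exact Unitary.coe_star_mul_self r.V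
    · rw [map_mul, map_star, map_one, eval_v]; exact Unitary.coe_mul_star_self r.V⟩

lemma u_mul_v (α : ℝ) :
    (uUnitary α : Ambient α) * vUnitary α = (phase α : ℂ) • ((vUnitary α : Ambient α) * uUnitary α) :=
  Ambient.ext fun r => by
    rw [map_mul, map_smul, map_mul]
    exact r.comm

lemma v_mul_u (α : ℝ) : (vUnitary α : Ambient α) * uUnitary α =
    (((phase α)⁻¹ : Circle) : ℂ) • ((uUnitary α : Ambient α) * vUnitary α) := by
  rw [u_mul_v, smul_smul, ← Circle.coe_mul, inv_mul_cancel, Circle.coe_one, one_smul]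

/-- The vector state of `δ_0` in the regular representation. -/
noncomputable def traceAmb (α : ℝ) : Ambient α →L[ℂ] ℂ :=
  LinearMap.mkContinuous
    { toFun := fun a => inner ℂ (delta 0) (eval (regularRep α) a (delta 0))
      map_add' := fun _ _ => inner_add_right _ _ _
      map_smul' := fun _ _ => inner_smul_right _ _ _ } (‖delta 0‖ * ‖delta 0‖) fun a => by
    have h1 : ‖eval (regularRep α) a‖ ≤ ‖a‖ := (Ambient.norm_le (norm_nonneg a)).1 le_rfl _
    calc ‖inner ℂ (delta 0) (eval (regularRep α) a (delta 0))‖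
        ≤ ‖delta 0‖ * ‖eval (regularRep α) a (delta 0)‖ := norm_inner_le_norm _ _
      _ ≤ ‖delta 0‖ * (‖a‖ * ‖delta 0‖) := by
        gcongr
        exact (ContinuousLinearMap.le_opNorm _ _).trans (by gcongr)
      _ = _ := by ring

lemma traceAmb_apply (α : ℝ) (a : Ambient α) :
    traceAmb α a = inner ℂ (delta 0) (eval (regularRep α) a (delta 0)) := rfl

lemma inner_delta (i j : ℤ × ℤ) : inner ℂ (delta i) (delta j) = if i = j then (1 : ℂ) else 0 := by
  have h : inner ℂ (delta i) (delta j) = inner ℂ (1 : ℂ) ((delta j).coord i) :=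
    lp.inner_single_left (𝕜 := ℂ) (G := fun _ : ℤ × ℤ => ℂ) i (1 : ℂ) (delta j)
  rw [h, delta_coord]
  split_ifs <;> simp

lemma weightedUnitary_delta (c : ℤ × ℤ → Circle) (d i : ℤ × ℤ) :
    (weightedUnitary c (Equiv.addRight d) : Hil →L[ℂ] Hil) (delta i) =
      (c (i + d) : ℂ) • delta (i + d) := by
  refine Hil.ext fun j => ?_
  rw [weightedUnitary_coord]
  change _ = (c (i + d) : ℂ) * (delta (i + d)).coord j
  rw [delta_coord, delta_coord]
  have : (Equiv.addRight d).symm j = i ↔ j = i + d := by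
    rw [Equiv.symm_apply_eq]; rfl
  simp only [this]
  split_ifs with h
  · rw [h]
  · simp

lemma exists_weightedUnitary_zpow_delta (c : ℤ × ℤ → Circle) (d i : ℤ × ℤ) (n : ℤ) :
    ∃ z : ℂ, (((weightedUnitary c (Equiv.addRight d)) ^ n : unitary (Hil →L[ℂ] Hil)) :
      Hil →L[ℂ] Hil) (delta i) = z • delta (i + n • d) := by
  set W := weightedUnitary c (Equiv.addRight d) with hW
  have hinv : ∀ j, ((W⁻¹ : unitary (Hil →L[ℂ] Hil)) : Hil →L[ℂ] Hil) (delta j) =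
      (c j : ℂ)⁻¹ • delta (j - d) := fun j => by
    have h1 := weightedUnitary_delta c d (j - d)
    rw [sub_add_cancel, ← hW] at h1
    have h2 : ((W⁻¹ : unitary (Hil →L[ℂ] Hil)) : Hil →L[ℂ] Hil)
        ((W : Hil →L[ℂ] Hil) (delta (j - d))) = delta (j - d) := by
      rw [← mul_apply_eq_comp, ← Submonoid.coe_mul, inv_mul_cancel]; rfl
    rw [h1, map_smul] at h2
    rw [← h2, smul_smul, inv_mul_cancel₀ (Circle.coe_ne_zero _), one_smul]
  induction n with
  | zero => exact ⟨1, by simp⟩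
  | succ n ih =>
    obtain ⟨z, hz⟩ := ih
    refine ⟨z * c (i + (n : ℤ) • d + d), ?_⟩
    rw [add_comm, zpow_add, zpow_one, Submonoid.coe_mul, mul_apply_eq_comp, hz, map_smul,
      weightedUnitary_delta, smul_smul, add_smul, one_smul, add_assoc, add_comm d]
  | pred n ih =>
    obtain ⟨z, hz⟩ := ih
    refine ⟨z * (c (i + (-n : ℤ) • d) : ℂ)⁻¹, ?_⟩
    rw [sub_eq_neg_add, zpow_add, zpow_neg_one, Submonoid.coe_mul, mul_apply_eq_comp, hz,
      map_smul, hinv, smul_smul, add_smul, neg_one_smul, ← sub_eq_neg_add, add_sub_assoc]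

lemma eval_mon {α : ℝ} (r : RotPair α) (U V : unitary (Ambient α)) {U' V' : unitary (Hil →L[ℂ] Hil)}
    (hU : eval r U = U') (hV : eval r V = V') (w : ℤ × ℤ) :
    eval r (TwistedTorus.mon U V w) = ((V' ^ w.2 * U' ^ w.1 : unitary (Hil →L[ℂ] Hil)) :
      Hil →L[ℂ] Hil) := by
  let t : Ambient α →⋆* (Hil →L[ℂ] Hil) := ⟨(eval r : Ambient α →* _), fun a => map_star _ a⟩
  have h1 : Unitary.map t U = U' := Subtype.ext hU
  have h2 : Unitary.map t V = V' := Subtype.ext hV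
  have h3 : eval r (TwistedTorus.mon U V w) =
    ((Unitary.map t (V ^ w.2 * U ^ w.1) : unitary (Hil →L[ℂ] Hil)) : Hil →L[ℂ] Hil) := rfl
  rw [h3, map_mul, map_zpow, map_zpow, h1, h2]

/-- In the regular representation a monomial moves `δ_0` to a multiple of another basis vector,
unless its exponents vanish. General shifts `d`, `d'` allow both orders of the generators. -/
lemma traceAmb_mon {α : ℝ} (U V : unitary (Ambient α)) {c c' : ℤ × ℤ → Circle} {d d' : ℤ × ℤ}
    (hU : eval (regularRep α) U = weightedUnitary c (Equiv.addRight d))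
    (hV : eval (regularRep α) V = weightedUnitary c' (Equiv.addRight d'))
    (hd : ∀ m n : ℤ, 0 = m • d + n • d' → m = 0 ∧ n = 0) (w : ℤ × ℤ) :
    traceAmb α (TwistedTorus.mon U V w) = if w = 0 then 1 else 0 := by
  rw [traceAmb_apply, eval_mon _ U V hU hV]
  split_ifs with h
  · rw [h]
    have h0 : inner ℂ (delta 0) (delta 0) = (1 : ℂ) := by rw [inner_delta, if_pos rfl]
    rw [Prod.fst_zero, Prod.snd_zero, zpow_zero, zpow_zero, mul_one]
    exact h0
  · obtain ⟨z, hz⟩ := exists_weightedUnitary_zpow_delta c d 0 w.1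
    obtain ⟨z', hz'⟩ := exists_weightedUnitary_zpow_delta c' d' (0 + w.1 • d) w.2
    rw [Submonoid.coe_mul, mul_apply_eq_comp, hz, map_smul, hz', inner_smul_right,
      inner_smul_right, inner_delta, if_neg, mul_zero, mul_zero]
    rw [zero_add]
    exact fun h0 => h (Prod.ext (hd _ _ h0).1 (hd _ _ h0).2)

lemma isClosed_rotationAlgebra (α : ℝ) : IsClosed (rotationAlgebra α : Set (Ambient α)) :=
  StarSubalgebra.isClosed_topologicalClosure _

lemma exists_fixed_of_ambient {α : ℝ} {e : Ambient α} (he : e ∈ rotationAlgebra α)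
    (hp : IsStarProjection e) (hσ : sigmaAmb α e = e) {t : ℂ} (ht : traceAmb α e = t) :
    ∃ e ∈ fixedAlgebra α, IsStarProjection e ∧ trace α e = t :=
  ⟨⟨e, he⟩, mem_fixedAlgebra.2 (Subtype.ext hσ),
    ⟨Subtype.ext hp.isIdempotentElem, Subtype.ext hp.isSelfAdjoint⟩, ht⟩

/-- A summable self-adjoint idempotent for the twisted convolution on `ℤ²` which is invariant
under the rotation by a right angle. -/
structure IsInvariantIdempotent (c : Circle) (E : ℤ × ℤ → ℂ) : Prop where
  summable : Summable fun w => ‖E w‖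
  mul : ∀ w, ∑' l, E l * (((c ^ (l.1 * (w - l).2) : Circle) : ℂ) * E (w - l)) = E w
  star : ∀ w, E (-w) = ((c ^ (w.1 * w.2) : Circle) : ℂ) * conj (E w)
  rotate : ∀ w : ℤ × ℤ, E (-w.2, w.1) = conj ((c ^ (w.1 * w.2) : Circle) : ℂ) * E w

lemma uUnitary_mem (α : ℝ) : (uUnitary α : Ambient α) ∈ rotationAlgebra α := (u α).2

lemma vUnitary_mem (α : ℝ) : (vUnitary α : Ambient α) ∈ rotationAlgebra α := (v α).2

lemma exists_projection {α : ℝ} {E : ℤ × ℤ → ℂ} (hE : IsInvariantIdempotent (phase α) E) :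
    ∃ e ∈ fixedAlgebra α, IsStarProjection e ∧ trace α e = E 0 := by
  refine exists_fixed_of_ambient
    (TwistedTorus.tsum_mon_mem (U := uUnitary α) (V := vUnitary α) (rotationAlgebra α)
      (isClosed_rotationAlgebra α) (uUnitary_mem α) (vUnitary_mem α) E)
    (TwistedTorus.isStarProjection_tsum_mon (u_mul_v α) hE.summable hE.mul hE.star)
    (TwistedTorus.map_tsum_mon_fixed (u_mul_v α) hE.summable hE.rotate (sigmaAmb α)
      (continuous_sigmaAmb α) rfl rfl)
    (TwistedTorus.map_tsum_mon_eq hE.summable (traceAmb α) fun w => ?_)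
  refine traceAmb_mon _ _ (c := fun _ => 1) (d := (1, 0)) (c' := fun i => phase α ^ (-i.1))
    (d' := (0, 1)) rfl rfl (fun m n h => ?_) w
  simpa [Prod.ext_iff, eq_comm] using h

/-- Exchanging `u` and `v` inverts the phase. The automorphism `v ↦ u`, `u ↦ v⁻¹` is then `σ³ =
σ⁻¹`, which has the same fixed points as `σ`. -/
lemma exists_projection_inv {α : ℝ} {E : ℤ × ℤ → ℂ} (hE : IsInvariantIdempotent (phase α)⁻¹ E) :
    ∃ e ∈ fixedAlgebra α, IsStarProjection e ∧ trace α e = E 0 := by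
  set s : Ambient α →⋆ₐ[ℂ] Ambient α := (sigmaAmb α).comp ((sigmaAmb α).comp (sigmaAmb α)) with hs
  have hsc : Continuous s :=
    (continuous_sigmaAmb α).comp ((continuous_sigmaAmb α).comp (continuous_sigmaAmb α))
  have hsu : s (uAmb α) = star (vAmb α) := by
    change sigmaAmb α (sigmaAmb α (sigmaAmb α (uAmb α))) = _
    rw [sigmaAmb_u, sigmaAmb_v, map_star, sigmaAmb_u]
  have hsv : s (vAmb α) = uAmb α := by
    change sigmaAmb α (sigmaAmb α (sigmaAmb α (vAmb α))) = _
    rw [sigmaAmb_v, map_star, sigmaAmb_u, map_star, sigmaAmb_v, star_star]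
  have hfix := TwistedTorus.map_tsum_mon_fixed (v_mul_u α) hE.summable hE.rotate s hsc hsv hsu
  refine exists_fixed_of_ambient
    (TwistedTorus.tsum_mon_mem (U := vUnitary α) (V := uUnitary α) (rotationAlgebra α)
      (isClosed_rotationAlgebra α) (vUnitary_mem α) (uUnitary_mem α) E)
    (TwistedTorus.isStarProjection_tsum_mon (v_mul_u α) hE.summable hE.mul hE.star) ?_
    (TwistedTorus.map_tsum_mon_eq hE.summable (traceAmb α) fun w => ?_)
  · conv_lhs => rw [← hfix]
    refine Ambient.ext fun r => ?_
    change eval r.rotate.rotate.rotate.rotate _ = _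
    rw [RotPair.rotate_four]
  · refine traceAmb_mon _ _ (c' := fun _ => 1) (d' := (1, 0)) (c := fun i => phase α ^ (-i.1))
      (d := (0, 1)) rfl rfl (fun m n h => ?_) w
    simpa [Prod.ext_iff, eq_comm, and_comm] using h

end RotationAlgebra

/-! ### Matrix coefficients of the window -/

namespace Heisenberg

variable {q : ℕ} [NeZero q]

lemma pairing_add_left (x y z : M q) : pairing (x + y) z = pairing x z * pairing y z := by
  simp only [pairing, Prod.fst_add, Prod.snd_add, add_mul, AddChar.map_add_eq_mul]
  exact mul_mul_mul_comm _ _ _ _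

lemma pairing_add_right (x y z : M q) : pairing x (y + z) = pairing x y * pairing x z := by
  simp only [pairing, Prod.fst_add, Prod.snd_add, mul_add, AddChar.map_add_eq_mul]
  exact mul_mul_mul_comm _ _ _ _

lemma pairing_zero_right (x : M q) : pairing x 0 = 1 := by
  simp [pairing]

lemma heis_coeFn (x : G q) (f : L2 q) :
    heis x f =ᵐ[haar q] fun t => (pairing t x.2 : ℂ) * f (t + x.1) :=
  (memLp_heis x f).coeFn_toLp

/-- The Heisenberg representation as a projective representation. -/
noncomputable def heisRep (q : ℕ) [NeZero q] : ProjRep (G q) (L2 q) where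
  β := bichar
  op := heis
  add_left x y z := pairing_add_left _ _ _
  add_right x y z := pairing_add_right _ _ _
  op_op x y f := by
    refine Lp.ext ?_
    filter_upwards [heis_coeFn x (heis y f), heis_coeFn (x + y) f,
      (measurePreserving_add x.1).quasiMeasurePreserving.ae (heis_coeFn y f),
      Lp.coeFn_smul (bichar x y : ℂ) (heis (x + y) f)] with t h1 h2 h3 h4
    rw [h1, h3, h4, Pi.smul_apply, h2, pairing_add_left, Prod.snd_add, Prod.fst_add,
      pairing_add_right, bichar, ← add_assoc, smul_eq_mul, Circle.coe_mul, Circle.coe_mul]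
    ring
  op_zero f := by
    refine Lp.ext ?_
    filter_upwards [heis_coeFn 0 f] with t h1
    rw [h1, Prod.snd_zero, Prod.fst_zero, pairing_zero_right, add_zero, Circle.coe_one, one_mul]

/-- The finite factor `1 + √q δ_0` of the window. -/
noncomputable def finWindow (q : ℕ) (n : ZMod q) : ℂ := 1 + if n = 0 then (Real.sqrt q : ℂ) else 0

omit [NeZero q] in
lemma conj_finWindow (n : ZMod q) : conj (finWindow q n) = finWindow q n := by
  unfold finWindow
  split_ifs <;> simp

omit [NeZero q] in
lemma phiTilde_eq (t : M q) :
    phiTilde q t = Complex.exp (-Real.pi * t.1 ^ 2) * finWindow q t.2 := by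
  simp [phiTilde, finWindow]

lemma measurable_phiTilde : Measurable (phiTilde q) := by
  have h1 : Measurable fun t : M q => Complex.exp (-Real.pi * t.1 ^ 2) := by
    have : Continuous fun s : ℝ => Complex.exp (-Real.pi * s ^ 2) := by fun_prop
    exact this.measurable.comp measurable_fst
  have h2 : Measurable fun t : M q => finWindow q t.2 :=
    (measurable_of_countable (finWindow q)).comp measurable_snd
  have h3 : phiTilde q = fun t : M q => Complex.exp (-Real.pi * t.1 ^ 2) * finWindow q t.2 :=
    funext phiTilde_eq
  rw [h3]
  exact h1.mul h2

lemma memLp_phiTilde : MemLp (phiTilde q) 2 (haar q) := by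
  rw [memLp_two_iff_integrable_sq_norm measurable_phiTilde.aestronglyMeasurable]
  have h1 : Integrable fun s : ℝ => Real.exp (-(2 * Real.pi) * s ^ 2) :=
    integrable_exp_neg_mul_sq (by positivity)
  have h2 : Integrable (fun n : ZMod q => ‖finWindow q n‖ ^ 2)
      (Real.toNNReal (1 / Real.sqrt q) • (Measure.count : Measure (ZMod q))) :=
    Integrable.of_finite
  refine (h1.mul_prod h2).congr (Filter.Eventually.of_forall fun t => ?_)
  simp only
  rw [phiTilde_eq, norm_mul, mul_pow, Complex.norm_exp, ← Real.exp_nat_mul]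
  congr 2
  norm_cast
  ring

/-- The window `φ̃` as an element of `L²(M)`. -/
noncomputable def window (q : ℕ) [NeZero q] : L2 q := memLp_phiTilde.toLp (phiTilde q)

lemma heis_window_coeFn (x : G q) :
    heis x (window q) =ᵐ[haar q] fun t => (pairing t x.2 : ℂ) * phiTilde q (t + x.1) := by
  filter_upwards [heis_coeFn x (window q),
    (measurePreserving_add x.1).quasiMeasurePreserving.ae (memLp_phiTilde (q := q)).coeFn_toLp]
    with t h1 h2
  rw [h1, window, h2]

/-- The real factor of the matrix coefficients. -/
noncomputable def realCoeff (w x : ℝ × ℝ) : ℂ :=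
  ((√2)⁻¹ : ℝ) * Complex.exp (-Real.pi * ((x.1 - w.1) ^ 2 + (x.2 - w.2) ^ 2) / 2 -
    Real.pi * Complex.I * (x.1 + w.1) * (x.2 - w.2))

/-- The finite factor of the matrix coefficients. -/
noncomputable def finCoeff (w x : ZMod q × ZMod q) : ℂ :=
  ((1 / √q : ℝ) : ℂ) * ∑ t : ZMod q, conj ((ZMod.toCircle (t * w.2) : ℂ) * finWindow q (t + w.1)) *
    ((ZMod.toCircle (t * x.2) : ℂ) * finWindow q (t + x.1))

lemma integral_real_eq (w x : ℝ × ℝ) :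
    ∫ s : ℝ, conj ((Real.fourierChar (s * w.2) : ℂ) * Complex.exp (-Real.pi * (s + w.1 : ℝ) ^ 2)) *
      ((Real.fourierChar (s * x.2) : ℂ) * Complex.exp (-Real.pi * (s + x.1 : ℝ) ^ 2)) =
      realCoeff w x := by
  have hb : (-(2 * Real.pi : ℂ)).re < 0 := by
    simp [Real.pi_pos]
  have h := integral_cexp_quadratic hb (-(2 * Real.pi) * (w.1 + x.1) +
    2 * Real.pi * Complex.I * (x.2 - w.2)) (-Real.pi * (w.1 ^ 2 + x.1 ^ 2))
  have hπ : (Real.pi : ℂ) ≠ 0 := by exact_mod_cast Real.pi_ne_zero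
  have hc : ((Real.pi : ℂ) / -(-(2 * Real.pi))) ^ (1 / 2 : ℂ) = (((√2)⁻¹ : ℝ) : ℂ) := by
    have e : ((Real.pi : ℂ) / -(-(2 * Real.pi))) = ((2⁻¹ : ℝ) : ℂ) := by
      push_cast; field_simp
    rw [e, ← Real.sqrt_inv, Real.sqrt_eq_rpow, Complex.ofReal_cpow (by positivity)]
    norm_num
  rw [hc] at h
  rw [realCoeff]
  refine Eq.trans (integral_congr_ae (Filter.Eventually.of_forall fun s => ?_)) (h.trans ?_)
  · simp only [map_mul, ← Complex.exp_conj, Real.fourierChar_apply]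
    simp only [← Complex.exp_add]
    congr 1
    simp only [map_neg, map_pow, Complex.conj_ofReal, Complex.conj_I]
    push_cast
    ring
  · congr 2
    field_simp
    linear_combination ((x.2 - w.2 : ℂ) ^ 2 * 4) * Complex.I_sq

lemma integral_haar_mul (f : ℝ → ℂ) (g : ZMod q → ℂ) :
    ∫ t, f t.1 * g t.2 ∂(haar q) = (∫ s, f s) * (((1 / √q : ℝ) : ℂ) * ∑ n, g n) := by
  have h : ∫ n, g n ∂(Real.toNNReal (1 / √q) • (Measure.count : Measure (ZMod q))) =
      ((1 / √q : ℝ) : ℂ) * ∑ n, g n := by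
    rw [integral_smul_nnreal_measure, integral_count, NNReal.smul_def,
      Real.coe_toNNReal _ (by positivity), Complex.real_smul]
  rw [haar, integral_prod_mul, h]

lemma inner_heis_window (w x : G q) : inner ℂ (heis w (window q)) (heis x (window q)) =
    realCoeff (w.1.1, w.2.1) (x.1.1, x.2.1) * finCoeff (w.1.2, w.2.2) (x.1.2, x.2.2) := by
  rw [L2.inner_def, ← integral_real_eq, finCoeff, ← integral_haar_mul]
  refine integral_congr_ae ?_
  filter_upwards [heis_window_coeFn w, heis_window_coeFn x] with t h1 h2
  rw [h1, h2, RCLike.inner_apply, phiTilde_eq, phiTilde_eq, pairing, pairing, Circle.coe_mul,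
    Circle.coe_mul]
  simp only [map_mul, Prod.fst_add, Prod.snd_add]
  ring

lemma innerCoeff_phiTilde (z : G q) :
    innerCoeff (phiTilde q) (phiTilde q) z = (heisRep q).coeff (window q) z := by
  rw [ProjRep.coeff, L2.inner_def]
  refine integral_congr_ae ?_
  filter_upwards [heis_window_coeFn z, (memLp_phiTilde (q := q)).coeFn_toLp] with t h1 h2
  change _ = inner ℂ (window q t) (heis z (window q) t)
  rw [h1, window, h2, RCLike.inner_apply]
  ring

lemma coeff_window (z : G q) : (heisRep q).coeff (window q) z =
    realCoeff 0 (z.1.1, z.2.1) * finCoeff 0 (z.1.2, z.2.2) := by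
  have h := inner_heis_window (0 : G q) z
  rw [show heis (0 : G q) (window q) = window q from (heisRep q).op_zero _] at h
  exact h

end Heisenberg

/-! ### Size and quarter-turn symmetry of the coefficients -/

namespace Heisenberg

variable {q : ℕ} [NeZero q]

lemma sum_toCircle (m : ZMod q) :
    ∑ t : ZMod q, (ZMod.toCircle (t * m) : ℂ) = if m = 0 then (q : ℂ) else 0 := by
  have h := AddChar.sum_mulShift m (ZMod.isPrimitive_stdAddChar q)
  simpa [ZMod.stdAddChar_apply] using h

lemma sqrt_natCast_pos (q : ℕ) [NeZero q] : 0 < √(q : ℝ) :=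
  Real.sqrt_pos.2 (by exact_mod_cast Nat.pos_of_neZero q)

/-- The four terms are the products of the constant and the point mass in the two copies of the
window. The weight `√q` makes these two parts exchange under the Fourier transform of `ℤ/q`. -/
lemma finCoeff_zero_left (n m : ZMod q) : finCoeff 0 (n, m) =
    (if m = 0 then (√q : ℂ) else 0) + 1 + conj (ZMod.toCircle (n * m) : ℂ) +
      if n = 0 then (√q : ℂ) else 0 := by
  have hq := sqrt_natCast_pos q
  have hqc : (√(q : ℝ) : ℂ) ≠ 0 := by exact_mod_cast hq.ne'
  have hsq : (√(q : ℝ) : ℂ) * (√(q : ℝ) : ℂ) = q := by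
    rw [← Complex.ofReal_mul, Real.mul_self_sqrt (by positivity)]; simp
  have hterm : ∀ t : ZMod q, conj ((ZMod.toCircle (t * 0) : ℂ) * finWindow q (t + 0)) *
      ((ZMod.toCircle (t * m) : ℂ) * finWindow q (t + n)) =
      (ZMod.toCircle (t * m) : ℂ) + (if t = 0 then (√q : ℂ) else 0) +
      (if t = -n then (√q : ℂ) * conj (ZMod.toCircle (n * m) : ℂ) else 0) +
      (if t = 0 then (if n = 0 then (q : ℂ) else 0) else 0) := fun t => by
    rw [mul_zero, AddChar.map_zero_eq_one, Circle.coe_one, one_mul, add_zero, conj_finWindow,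
      finWindow, finWindow]
    have h1 : t + n = 0 ↔ t = -n := add_eq_zero_iff_eq_neg
    simp only [h1]
    have h2 : conj (ZMod.toCircle (n * m) : ℂ) = (ZMod.toCircle (-n * m) : ℂ) := by
      rw [neg_mul, AddChar.map_neg_eq_inv, Circle.coe_inv_eq_conj]
    rw [h2]
    by_cases h0 : t = 0
    · subst h0
      by_cases hn : n = 0
      · subst hn
        simp
        linear_combination hsq
      · have : (0 : ZMod q) ≠ -n := fun h => hn (by simpa using h.symm)
        simp [hn]
    · by_cases ht : t = -n
      · subst ht
        simp [h0]
        ring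
      · simp [h0, ht]
  rw [finCoeff]
  simp only [Prod.fst_zero, Prod.snd_zero, hterm]
  rw [Finset.sum_add_distrib, Finset.sum_add_distrib, Finset.sum_add_distrib, sum_toCircle]
  simp only [Finset.sum_ite_eq', Finset.mem_univ, if_true]
  push_cast
  have e : (1 : ℂ) / √(q : ℝ) * q = √(q : ℝ) := by rw [← hsq]; field_simp
  have e1 : (1 : ℂ) / √(q : ℝ) * √(q : ℝ) = 1 := one_div_mul_cancel hqc
  have hm : ∀ (p : Prop) [Decidable p], (1 : ℂ) / √(q : ℝ) * (if p then (q : ℂ) else 0) =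
      if p then (√q : ℂ) else 0 := fun p _ => by
    split_ifs
    · exact e
    · exact mul_zero _
  linear_combination hm (m = 0) + hm (n = 0) + (1 + conj (ZMod.toCircle (n * m) : ℂ)) * e1

lemma finCoeff_zero_zero : finCoeff (0 : ZMod q × ZMod q) 0 = ((2 * √q + 2 : ℝ) : ℂ) := by
  have h := finCoeff_zero_left (0 : ZMod q) 0
  rw [show ((0 : ZMod q), (0 : ZMod q)) = 0 from rfl] at h
  rw [h]
  simp
  ring

lemma norm_finCoeff_le (x : ZMod q × ZMod q) : ‖finCoeff 0 x‖ ≤ 2 * √q + 2 := by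
  have hq := sqrt_natCast_pos q
  have hb : ∀ (p : Prop) [Decidable p], ‖if p then (√q : ℂ) else 0‖ ≤ √q := fun p _ => by
    split_ifs
    · rw [Complex.norm_real, Real.norm_of_nonneg hq.le]
    · simp
  obtain ⟨n, m⟩ := x
  rw [finCoeff_zero_left]
  have h1 := norm_add_le ((if m = 0 then (√q : ℂ) else 0) + 1 + conj (ZMod.toCircle (n * m) : ℂ))
    (if n = 0 then (√q : ℂ) else 0)
  have h2 := norm_add_le ((if m = 0 then (√q : ℂ) else 0) + 1) (conj (ZMod.toCircle (n * m) : ℂ))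
  have h3 := norm_add_le (if m = 0 then (√q : ℂ) else 0) 1
  rw [RCLike.norm_conj, Circle.norm_coe] at h2
  rw [norm_one] at h3
  linarith [hb (m = 0), hb (n = 0)]

lemma norm_realCoeff_zero_left (x : ℝ × ℝ) : ‖realCoeff 0 x‖ =
    (√2)⁻¹ * (Real.exp (-Real.pi * x.1 ^ 2 / 2) * Real.exp (-Real.pi * x.2 ^ 2 / 2)) := by
  rw [realCoeff, norm_mul, Complex.norm_real, Real.norm_of_nonneg (by positivity), Complex.norm_exp,
    ← Real.exp_add]
  congr 2
  have : (-Real.pi * ((x.1 - (0 : ℝ × ℝ).1) ^ 2 + (x.2 - (0 : ℝ × ℝ).2) ^ 2) / 2 -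
    Real.pi * Complex.I * (x.1 + (0 : ℝ × ℝ).1) * (x.2 - (0 : ℝ × ℝ).2) : ℂ) =
    ((-Real.pi * (x.1 ^ 2 + x.2 ^ 2) / 2 : ℝ) : ℂ) + ((-Real.pi * x.1 * x.2 : ℝ) : ℂ) * Complex.I := by
    push_cast
    simp
    ring
  rw [this]
  simp only [Complex.add_re, Complex.ofReal_re, Complex.re_ofReal_mul, Complex.I_re]
  ring

/-- The squared norm of the window. -/
lemma norm_window_sq : ‖window q‖ ^ 2 = (√2)⁻¹ * (2 * √q + 2) := by
  have h := (heisRep q).norm_coeff_zero (window q)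
  rw [← h, coeff_window, norm_mul]
  have h1 : ‖finCoeff (0 : ZMod q × ZMod q) ((0 : G q).1.2, (0 : G q).2.2)‖ = 2 * √q + 2 := by
    have := sqrt_natCast_pos q
    rw [show ((0 : G q).1.2, (0 : G q).2.2) = 0 from rfl, finCoeff_zero_zero, Complex.norm_real,
      Real.norm_of_nonneg (by positivity)]
  rw [h1, norm_realCoeff_zero_left]
  simp

/-- The finite factor is largest at `0`, where all four of its terms attain their bounds, so it is
absorbed into `‖φ‖²` and only the real Gaussian remains. -/
lemma norm_coeff_window_le (z : G q) : ‖(heisRep q).coeff (window q) z‖ ≤ ‖window q‖ ^ 2 *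
    (Real.exp (-Real.pi * z.1.1 ^ 2 / 2) * Real.exp (-Real.pi * z.2.1 ^ 2 / 2)) := by
  rw [coeff_window, norm_mul, norm_window_sq, norm_realCoeff_zero_left]
  calc _ ≤ (√2)⁻¹ * (Real.exp (-Real.pi * z.1.1 ^ 2 / 2) * Real.exp (-Real.pi * z.2.1 ^ 2 / 2)) *
        (2 * √q + 2) := by
        gcongr
        exact norm_finCoeff_le _
    _ = _ := by ring

/-- The rotation by a right angle of phase space. -/
def rotate (q : ℕ) : G q →+ G q where
  toFun z := (-z.2, z.1)
  map_zero' := by simp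
  map_add' x y := by
    simp only [Prod.snd_add, Prod.fst_add, neg_add]
    rfl

lemma bichar_rotate (x y : G q) : bichar (rotate q x) (rotate q y) = (bichar y x)⁻¹ := by
  change pairing (-x.2) y.1 = (pairing y.1 x.2)⁻¹
  simp only [pairing, Prod.fst_neg, Prod.snd_neg, neg_mul, AddChar.map_neg_eq_inv, mul_inv,
    mul_comm x.2.1, mul_comm x.2.2]

/-- This expresses the Fourier invariance of the window through its coefficients, without
introducing the Fourier transform as an operator. -/
lemma coeff_window_rotate (x : G q) : (heisRep q).coeff (window q) (rotate q x) =
    ((heisRep q).β x x : ℂ) * (heisRep q).coeff (window q) x := by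
  obtain ⟨⟨s, n⟩, ⟨y, m⟩⟩ := x
  rw [coeff_window, coeff_window]
  change realCoeff 0 (-y, s) * finCoeff 0 (-m, n) =
    ((Real.fourierChar (s * y) * ZMod.toCircle (n * m) : Circle) : ℂ) *
      (realCoeff 0 (s, y) * finCoeff 0 (n, m))
  have h1 : realCoeff 0 (-y, s) = (Real.fourierChar (s * y) : ℂ) * realCoeff 0 (s, y) := by
    rw [realCoeff, realCoeff, Real.fourierChar_apply, mul_left_comm, ← Complex.exp_add]
    congr 2
    push_cast
    simp
    ring
  have h2 : finCoeff 0 (-m, n) = (ZMod.toCircle (n * m) : ℂ) * finCoeff 0 (n, m) := by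
    rw [finCoeff_zero_left, finCoeff_zero_left, neg_mul, AddChar.map_neg_eq_inv,
      Circle.coe_inv_eq_conj, Complex.conj_conj, mul_comm m n, mul_add, mul_add, mul_add,
      circle_mul_conj_self]
    simp only [neg_eq_zero]
    by_cases hm : m = 0
    · by_cases hn : n = 0
      · subst hm hn; simp
      · subst hm; simp [hn]; ring
    · by_cases hn : n = 0
      · subst hn; simp [hm]; ring
      · simp [hn, hm]; ring
  rw [h1, h2, Circle.coe_mul]
  ring

/-- The homomorphism `(k, l) ↦ (k (a, n), l (a, n))` of `ℤ²` into phase space. -/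
def grid (a : ℝ) (n : ZMod q) : ℤ × ℤ →+ G q :=
  (zmultiplesHom (M q) (a, n)).prodMap (zmultiplesHom (M q) (a, n))

omit [NeZero q] in
lemma grid_apply (a : ℝ) (n : ZMod q) (w : ℤ × ℤ) :
    grid a n w = ((w.1 * a, w.1 * n), (w.2 * a, w.2 * n)) := by
  obtain ⟨k, l⟩ := w
  change (k • ((a, n) : M q), l • ((a, n) : M q)) = _
  simp

omit [NeZero q] in
lemma rotate_grid (a : ℝ) (n : ZMod q) (w : ℤ × ℤ) :
    rotate q (grid a n w) = grid a n (-w.2, w.1) := by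
  rw [grid_apply, grid_apply]
  simp [rotate]

lemma bichar_grid (a b : ℝ) (n m : ZMod q) (w z : ℤ × ℤ) : bichar (grid a n w) (grid b m z) =
    (Real.fourierChar (a * b) * ZMod.toCircle (n * m)) ^ (w.1 * z.2) := by
  rw [grid_apply, grid_apply, bichar, pairing, mul_zpow, ← AddChar.map_zsmul_eq_zpow,
    ← AddChar.map_zsmul_eq_zpow]
  simp only [zsmul_eq_mul]
  push_cast
  congr 2 <;> ring

end Heisenberg

/-! ### Gaussian sums and the constant 0.948 -/

lemma summable_exp_neg_mul_int_sq {b : ℝ} (hb : 0 < b) :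
    Summable fun k : ℤ => Real.exp (-b * k ^ 2) := by
  have h := (summable_jacobiTheta₂_term_iff 0 (Complex.I * (b / Real.pi : ℝ))).2 (by
    simp; positivity)
  refine h.norm.congr fun k => ?_
  rw [norm_jacobiTheta₂_term]
  congr 1
  simp
  field_simp

/-- Translated Gaussian sums over `ℤ` are uniformly bounded. -/
lemma exists_forall_sum_exp_neg_le {a : ℝ} (ha : 0 < a) :
    ∃ C, 0 ≤ C ∧ ∀ (s : ℝ) (F : Finset ℤ), ∑ k ∈ F, Real.exp (-Real.pi * (k * a + s) ^ 2 / 2) ≤ C := by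
  have hb : 0 < Real.pi * a ^ 2 / 4 := by positivity
  have hs := summable_exp_neg_mul_int_sq hb
  refine ⟨Real.exp (Real.pi * a ^ 2 / 8) * ∑' k : ℤ, Real.exp (-(Real.pi * a ^ 2 / 4) * k ^ 2),
    mul_nonneg (Real.exp_pos _).le (tsum_nonneg fun _ => (Real.exp_pos _).le), fun s F => ?_⟩
  set n : ℤ := round (s / a) with hn
  have hr : |s / a - n| ≤ 1 / 2 := abs_sub_round _
  have hle : ∀ k : ℤ, Real.exp (-Real.pi * (k * a + s) ^ 2 / 2) ≤
      Real.exp (Real.pi * a ^ 2 / 8) * Real.exp (-(Real.pi * a ^ 2 / 4) * ((k + n : ℤ) : ℝ) ^ 2) :=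
    fun k => by
    rw [← Real.exp_add]
    refine Real.exp_le_exp.2 ?_
    set d := s / a - n with hd
    have e : (k * a + s) = a * (((k + n : ℤ) : ℝ) + d) := by
      rw [hd]; push_cast; field_simp; ring
    have hd2 : d ^ 2 ≤ 1 / 4 := by
      have := sq_le_sq' (abs_le.1 hr).1 (abs_le.1 hr).2
      linarith
    rw [e]
    -- With `m = k + n` this yields `(m + d)² ≥ m²/2 - d²`, and `d² ≤ 1/4` since `n` is the nearest
    -- integer to `s / a`.
    have key : 0 ≤ Real.pi * a ^ 2 * (((k + n : ℤ) : ℝ) + 2 * d) ^ 2 := by positivity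
    have key2 : 0 ≤ Real.pi * a ^ 2 * (1 / 4 - d ^ 2) := mul_nonneg (by positivity) (by linarith)
    nlinarith
  calc ∑ k ∈ F, Real.exp (-Real.pi * (k * a + s) ^ 2 / 2)
      ≤ ∑ k ∈ F, Real.exp (Real.pi * a ^ 2 / 8) *
          Real.exp (-(Real.pi * a ^ 2 / 4) * ((k + n : ℤ) : ℝ) ^ 2) :=
        Finset.sum_le_sum fun k _ => hle k
    _ = Real.exp (Real.pi * a ^ 2 / 8) * ∑ k ∈ F.map (Equiv.addRight n).toEmbedding,
          Real.exp (-(Real.pi * a ^ 2 / 4) * (k : ℝ) ^ 2) := by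
        rw [Finset.sum_map, Finset.mul_sum]; rfl
    _ ≤ _ := by
        gcongr
        exact hs.sum_le_tsum _ fun _ _ => (Real.exp_pos _).le

/-- The intermediate exponent is `1.625 = 13/8 < 3.14/1.896`, so the claim reduces to the comparison
`5⁸ < e¹³`. -/
lemma exp_neg_lt_of_lt {X : ℝ} (hX : 0 < X) (hX1 : X < 0.948) :
    Real.exp (-Real.pi / (2 * X)) < 0.2 := by
  have h1 : (1.625 : ℝ) < Real.pi / (2 * X) := by
    rw [lt_div_iff₀ (by positivity)]
    nlinarith [Real.pi_gt_d2]
  have h2 : (5 : ℝ) < Real.exp 1.625 := by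
    have h3 : Real.exp 1.625 ^ 8 = Real.exp 1 ^ 13 := by
      rw [← Real.exp_nat_mul, ← Real.exp_nat_mul]; norm_num
    have h4 : (5 : ℝ) ^ 8 < Real.exp 1 ^ 13 := by
      calc (5 : ℝ) ^ 8 < 2.7182818283 ^ 13 := by norm_num
        _ < _ := by
          have := Real.exp_one_gt_d9
          gcongr
    rw [← h3] at h4
    exact lt_of_pow_lt_pow_left₀ 8 (Real.exp_pos _).le h4
  have h5 : (5 : ℝ) < Real.exp (Real.pi / (2 * X)) := h2.trans (Real.exp_lt_exp.2 h1)
  rw [neg_div, Real.exp_neg, inv_lt_comm₀ (Real.exp_pos _) (by norm_num)]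
  linarith

lemma hasSum_int_of_even {f : ℤ → ℝ} (hf : ∀ k, f (-k) = f k) {a : ℝ}
    (h : HasSum (fun n : ℕ => f (n + 1)) a) : HasSum f (a + f 0 + a) := by
  have h1 : HasSum (fun n : ℕ => f n) (a + f 0) := by
    have := (hasSum_nat_add_iff (f := fun n : ℕ => f n) 1).1 (by simpa using h)
    simpa using this
  exact HasSum.of_nat_of_neg_add_one h1 (h.congr_fun fun n => hf _)

/-- The theta constant at `0.948` is less than `√2`. -/
lemma tsum_exp_neg_sq_lt {X : ℝ} (hX : 0 < X) (hX1 : X < 0.948) :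
    ∑' k : ℤ, Real.exp (-(Real.pi / (2 * X)) * k ^ 2) < 141 / 100 := by
  set t := Real.exp (-Real.pi / (2 * X)) with ht
  have ht0 : 0 < t := Real.exp_pos _
  have ht1 : t < 1 / 5 := by
    have := exp_neg_lt_of_lt hX hX1
    norm_num at this
    linarith
  have ht3 : t ^ 3 < (1 / 5) ^ 3 := by gcongr
  -- From `(n + 1)² ≥ 1 + 3n`, each half of the theta series is dominated by a geometric series of
  -- ratio `t³`, giving at most `t / (1 - t³) < 0.205` and a total below `1 + 2 · 0.205 = 1.41`.
  have hpow : ∀ n : ℕ, Real.exp (-(Real.pi / (2 * X)) * (((n : ℤ) + 1 : ℤ) : ℝ) ^ 2) ≤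
      t * (t ^ 3) ^ n := fun n => by
    have e : t * (t ^ 3) ^ n = Real.exp (-(Real.pi / (2 * X)) * (1 + 3 * n)) := by
      rw [← pow_mul, ← Real.exp_nat_mul, ← Real.exp_add]
      congr 1
      push_cast
      ring
    rw [e]
    refine Real.exp_le_exp.2 ?_
    have h1 : (n : ℝ) ≤ (n : ℝ) ^ 2 := by exact_mod_cast Nat.le_self_pow two_ne_zero n
    have h2 : 0 < Real.pi / (2 * X) := by positivity
    push_cast
    nlinarith
  have hg := (hasSum_geometric_of_lt_one (r := t ^ 3) (by positivity) (by linarith)).mul_left t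
  have hs1 : Summable fun n : ℕ => Real.exp (-(Real.pi / (2 * X)) * (((n : ℤ) + 1 : ℤ) : ℝ) ^ 2) :=
    hg.summable.of_nonneg_of_le (fun _ => (Real.exp_pos _).le) hpow
  have hle := hasSum_le hpow hs1.hasSum hg
  rw [(hasSum_int_of_even (f := fun k : ℤ => Real.exp (-(Real.pi / (2 * X)) * (k : ℝ) ^ 2))
    (fun k => by simp) hs1.hasSum).tsum_eq]
  have hfin : t * (1 - t ^ 3)⁻¹ < 205 / 1000 := by
    rw [← div_eq_mul_inv, div_lt_iff₀ (by linarith)]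
    linarith
  have h0 : Real.exp (-(Real.pi / (2 * X)) * ((0 : ℤ) : ℝ) ^ 2) = 1 := by simp
  rw [h0]
  linarith

/-! ### The lattice `D`, its orthogonal `D^⊥` and invertibility -/

namespace Heisenberg

variable {q : ℕ} [NeZero q]

lemma summable_norm_coeff_grid {a : ℝ} (ha : 0 < a) (n : ZMod q) :
    Summable (fun w => ‖(heisRep q).coeff (window q) (grid a n w)‖) ∧
    ∑' w, ‖(heisRep q).coeff (window q) (grid a n w)‖ ≤
      ‖window q‖ ^ 2 * (∑' k : ℤ, Real.exp (-(Real.pi * a ^ 2 / 2) * k ^ 2)) ^ 2 := by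
  have hs := summable_exp_neg_mul_int_sq (b := Real.pi * a ^ 2 / 2) (by positivity)
  have hs2 := (hs.mul_of_nonneg hs (fun _ => (Real.exp_pos _).le)
    (fun _ => (Real.exp_pos _).le)).mul_left (‖window q‖ ^ 2)
  have hle : ∀ w : ℤ × ℤ, ‖(heisRep q).coeff (window q) (grid a n w)‖ ≤ ‖window q‖ ^ 2 *
      (Real.exp (-(Real.pi * a ^ 2 / 2) * w.1 ^ 2) * Real.exp (-(Real.pi * a ^ 2 / 2) * w.2 ^ 2)) :=
    fun w => by
    refine (norm_coeff_window_le _).trans (le_of_eq ?_)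
    rw [grid_apply]
    congr 3 <;> ring
  have hs3 := hs2.of_nonneg_of_le (fun w => norm_nonneg _) hle
  refine ⟨hs3, (hs3.tsum_le_tsum hle hs2).trans (le_of_eq ?_)⟩
  rw [tsum_mul_left, sq (tsum _)]
  congr 1
  exact (tsum_mul_tsum_of_summable_norm hs.norm hs.norm).symm

lemma exists_sum_norm_coeff_le {a : ℝ} (ha : 0 < a) (n : ZMod q) :
    ∃ C, ∀ (x : G q) (F : Finset (ℤ × ℤ)),
      ∑ w ∈ F, ‖(heisRep q).coeff (window q) (grid a n w + x)‖ ≤ C := by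
  classical
  obtain ⟨C, hC0, hC⟩ := exists_forall_sum_exp_neg_le ha
  refine ⟨‖window q‖ ^ 2 * (C * C), fun x F => ?_⟩
  calc ∑ w ∈ F, ‖(heisRep q).coeff (window q) (grid a n w + x)‖
      ≤ ∑ w ∈ F.image Prod.fst ×ˢ F.image Prod.snd,
          ‖(heisRep q).coeff (window q) (grid a n w + x)‖ :=
        Finset.sum_le_sum_of_subset_of_nonneg Finset.subset_product fun _ _ _ => norm_nonneg _
    _ ≤ ∑ w ∈ F.image Prod.fst ×ˢ F.image Prod.snd, ‖window q‖ ^ 2 *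
          (Real.exp (-Real.pi * (w.1 * a + x.1.1) ^ 2 / 2) *
            Real.exp (-Real.pi * (w.2 * a + x.2.1) ^ 2 / 2)) := by
        refine Finset.sum_le_sum fun w _ => (norm_coeff_window_le _).trans (le_of_eq ?_)
        rw [grid_apply]
        rfl
    _ = ‖window q‖ ^ 2 * ((∑ k ∈ F.image Prod.fst, Real.exp (-Real.pi * (k * a + x.1.1) ^ 2 / 2)) *
          ∑ k ∈ F.image Prod.snd, Real.exp (-Real.pi * (k * a + x.2.1) ^ 2 / 2)) := by
        rw [← Finset.mul_sum, Finset.sum_mul_sum, Finset.sum_product]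
    _ ≤ _ := by
        gcongr
        · exact hC _ _
        · exact hC _ _

lemma window_norm_pos : 0 < ‖window q‖ ^ 2 := by
  have := sqrt_natCast_pos q
  rw [norm_window_sq]
  positivity

/-- The Gaussian bound factors over the two coordinates, so the condition is that the square of the
theta constant at `q² γ` be less than 2; `1.41² < 2` suffices. -/
lemma tsum_norm_coeff_grid_lt {γ : ℝ} (hγ : 0 < γ) (hγ1 : γ < 0.948 / (q : ℝ) ^ 2) (n : ZMod q) :
    ∑' w, ‖(heisRep q).coeff (window q) (grid (1 / (q * √γ)) n w)‖ < 2 * ‖window q‖ ^ 2 := by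
  have hq : (0 : ℝ) < q := by exact_mod_cast Nat.pos_of_neZero q
  have hsγ : 0 < √γ := Real.sqrt_pos.2 hγ
  refine ((summable_norm_coeff_grid (by positivity) n).2).trans_lt ?_
  have hX : (q : ℝ) ^ 2 * γ < 0.948 := by
    rw [lt_div_iff₀ (by positivity)] at hγ1
    linarith
  have h := tsum_exp_neg_sq_lt (X := q ^ 2 * γ) (by positivity) hX
  have e : Real.pi * (1 / (q * √γ)) ^ 2 / 2 = Real.pi / (2 * (q ^ 2 * γ)) := by
    rw [div_pow, mul_pow, Real.sq_sqrt hγ.le]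
    field_simp
  rw [e, mul_comm]
  have h0 : 0 ≤ ∑' k : ℤ, Real.exp (-(Real.pi / (2 * (q ^ 2 * γ))) * k ^ 2) :=
    tsum_nonneg fun _ => (Real.exp_pos _).le
  have : (∑' k : ℤ, Real.exp (-(Real.pi / (2 * (q ^ 2 * γ))) * k ^ 2)) ^ 2 < 2 := by
    nlinarith
  nlinarith [window_norm_pos (q := q)]

lemma toCircle_one_mul_neg_inv {p₀ : ℤ} {r : ZMod q} (hr : r * p₀ = 1) :
    ZMod.toCircle ((p₀ : ZMod q) * -r) = (Real.fourierChar (1 / (q : ℝ)))⁻¹ := by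
  have h : (p₀ : ZMod q) * -r = -((1 : ℤ) : ZMod q) := by
    rw [mul_neg, mul_comm, hr]; simp
  rw [h, AddChar.map_neg_eq_inv]
  congr 1
  ext
  rw [ZMod.toCircle_intCast, Real.fourierChar_apply]
  congr 1
  push_cast
  ring

/-- On generators the real part contributes `e^{2πi/q}` and the finite part `e^{-2πi/q}`, whence the
sign of `-r`. -/
lemma bichar_grid_grid {γ : ℝ} (hγ : 0 < γ) {p₀ : ℤ} {r : ZMod q} (hr : r * p₀ = 1) (w z : ℤ × ℤ) :
    bichar (grid √γ (p₀ : ZMod q) w) (grid (1 / (q * √γ)) (-r) z) = 1 := by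
  have hsγ : 0 < √γ := Real.sqrt_pos.2 hγ
  have e : √γ * (1 / (q * √γ)) = 1 / (q : ℝ) := by field_simp
  rw [bichar_grid, e, toCircle_one_mul_neg_inv hr, mul_inv_cancel, one_zpow]

lemma bichar_grid_grid' {γ : ℝ} (hγ : 0 < γ) {p₀ : ℤ} {r : ZMod q} (hr : r * p₀ = 1) (w z : ℤ × ℤ) :
    bichar (grid (1 / (q * √γ)) (-r) z) (grid √γ (p₀ : ZMod q) w) = 1 := by
  have hsγ : 0 < √γ := Real.sqrt_pos.2 hγ
  have e : (1 / (q * √γ)) * √γ = 1 / (q : ℝ) := by field_simp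
  rw [bichar_grid, e, mul_comm (-r), toCircle_one_mul_neg_inv hr, mul_inv_cancel, one_zpow]

omit [NeZero q] in
lemma lattice_eq_range (γ : ℝ) (p₀ : ℤ) :
    lattice q γ p₀ = (grid √γ (p₀ : ZMod q)).range := by
  refine le_antisymm ((AddSubgroup.closure_le _).2 ?_) ?_
  · rintro x (rfl | rfl)
    · exact ⟨(1, 0), by rw [grid_apply]; simp⟩
    · exact ⟨(0, 1), by rw [grid_apply]; simp⟩
  · rintro _ ⟨w, rfl⟩
    have e : grid √γ (p₀ : ZMod q) w = w.1 • ((((√γ, (p₀ : ZMod q)) : M q), 0) : G q) +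
        w.2 • ((0, ((√γ, (p₀ : ZMod q)) : M q)) : G q) := by
      rw [grid_apply]
      simp
    rw [e]
    refine add_mem (zsmul_mem ?_ _) (zsmul_mem ?_ _) <;> refine AddSubgroup.subset_closure ?_
    · exact Set.mem_insert _ _
    · exact Set.mem_insert_of_mem _ rfl

/-- The annihilator of the cyclic subgroup generated by `(√γ, p₀)`. -/
lemma exists_of_pairing_eq_one {γ : ℝ} (hγ : 0 < γ) {p₀ : ℤ} {r : ZMod q} (hr : r * p₀ = 1) {x : M q}
    (h : pairing (√γ, (p₀ : ZMod q)) x = 1) :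
    ∃ k : ℤ, x = (k * (1 / (q * √γ)), k * -r) := by
  have hsγ : 0 < √γ := Real.sqrt_pos.2 hγ
  have hq : (0 : ℝ) < q := by exact_mod_cast Nat.pos_of_neZero q
  obtain ⟨s, n⟩ := x
  obtain ⟨n, rfl⟩ := ZMod.intCast_surjective n
  have h1 : (pairing (√γ, (p₀ : ZMod q)) (s, (n : ZMod q)) : ℂ) = 1 := by rw [h, Circle.coe_one]
  rw [pairing, Circle.coe_mul, Real.fourierChar_apply, ← Int.cast_mul, ZMod.toCircle_intCast,
    ← Complex.exp_add, Complex.exp_eq_one_iff] at h1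
  obtain ⟨j, hj⟩ := h1
  have h2 : √γ * s + p₀ * n / q = j := by
    have h2c : ((√γ * s + p₀ * n / q : ℝ) : ℂ) = (j : ℝ) := by
      have hpi : (2 * Real.pi * Complex.I : ℂ) ≠ 0 := Complex.two_pi_I_ne_zero
      refine mul_right_cancel₀ hpi ?_
      push_cast at hj ⊢
      rw [← hj]
      ring
    exact_mod_cast h2c
  -- Clearing denominators in `√γ s + p₀ n / q = j` gives this integer as the multiple for `s`;
  -- modulo `q` it is `-p₀ n`, and multiplication by `-r` returns `n`.
  refine ⟨j * q - p₀ * n, Prod.ext ?_ ?_⟩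
  · push_cast
    rw [← h2]
    field_simp
    ring
  · push_cast
    rw [CharP.cast_eq_zero, mul_zero, zero_sub]
    linear_combination (-(n : ZMod q)) * hr

lemma orth_lattice_eq {γ : ℝ} (hγ : 0 < γ) {p₀ : ℤ} {r : ZMod q} (hr : r * p₀ = 1) :
    orth (lattice q γ p₀) = Set.range (grid (1 / (q * √γ)) (-r)) := by
  rw [lattice_eq_range]
  ext z
  constructor
  · intro hz
    have h1 := hz _ ⟨(1, 0), rfl⟩
    have h2 := hz _ ⟨(0, 1), rfl⟩
    rw [grid_apply] at h1 h2
    simp only [bichar, Int.cast_one, Int.cast_zero, one_mul, zero_mul] at h1 h2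
    have e0 : ∀ x : M q, pairing (0, 0) x = 1 := fun x => by simp [pairing]
    have e1 : ∀ x : M q, pairing x (0, 0) = 1 := fun x => by simp [pairing]
    have e2 : ∀ x y : M q, pairing x y = pairing y x := fun x y => by
      simp only [pairing, mul_comm x.1, mul_comm x.2]
    rw [e1] at h1
    rw [e0, e2] at h2
    obtain ⟨l, hl⟩ := exists_of_pairing_eq_one hγ hr h1
    obtain ⟨k, hk⟩ := exists_of_pairing_eq_one hγ hr h2.symm
    exact ⟨(k, l), by rw [grid_apply]; exact Prod.ext hk.symm hl.symm⟩
  · rintro ⟨w, rfl⟩ _ ⟨v, rfl⟩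
    rw [bichar_grid_grid hγ hr, bichar_grid_grid' hγ hr]

omit [NeZero q] in
lemma grid_injective {a : ℝ} (ha : a ≠ 0) (n : ZMod q) : Function.Injective (grid a n) := by
  intro w z h
  rw [grid_apply, grid_apply, Prod.mk.injEq, Prod.mk.injEq, Prod.mk.injEq] at h
  refine Prod.ext ?_ ?_
  · exact_mod_cast mul_right_cancel₀ ha h.1.1
  · exact_mod_cast mul_right_cancel₀ ha h.2.1

lemma thetaElement_eq_frame {γ : ℝ} (hγ : 0 < γ) {p₀ : ℤ} {r : ZMod q} (hr : r * p₀ = 1) :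
    thetaElement q γ p₀ = (heisRep q).frame (window q) (grid (1 / (q * √γ)) (-r)) := by
  have hsγ : 0 < √γ := Real.sqrt_pos.2 hγ
  have hq : (0 : ℝ) < q := by exact_mod_cast Nat.pos_of_neZero q
  let e := (Equiv.ofInjective _ (grid_injective (q := q) (a := 1 / (q * √γ)) (by positivity) (-r))).trans
    (Equiv.setCongr (orth_lattice_eq hγ hr).symm)
  rw [thetaElement, innerOrth, ← e.tsum_eq, ProjRep.frame]
  refine tsum_congr fun w => ?_
  rw [innerCoeff_phiTilde]
  rfl

lemma isUnit_thetaElement {γ : ℝ} (hγ : 0 < γ) (hγ1 : γ < 0.948 / (q : ℝ) ^ 2) {p₀ : ℤ} {r : ZMod q}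
    (hr : r * p₀ = 1) : IsUnit (thetaElement q γ p₀) := by
  have hsγ : 0 < √γ := Real.sqrt_pos.2 hγ
  have hq : (0 : ℝ) < q := by exact_mod_cast Nat.pos_of_neZero q
  rw [thetaElement_eq_frame hγ hr]
  exact (heisRep q).isUnit_frame (summable_norm_coeff_grid (by positivity) (-r)).1
    (tsum_norm_coeff_grid_lt hγ hγ1 (-r))

end Heisenberg

/-! ### Fourier inversion on the finite phase space -/

namespace Heisenberg

variable {q : ℕ} [NeZero q]

lemma sum_toCircle' (s t w : ZMod q) :
    ∑ m : ZMod q, (ZMod.toCircle (s * m) : ℂ) * conj (ZMod.toCircle (t * m) : ℂ) *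
      conj (ZMod.toCircle (w * m) : ℂ) = if s = t + w then (q : ℂ) else 0 := by
  have h := sum_toCircle (s - (t + w))
  simp only [sub_eq_zero] at h
  rw [← h]
  refine Finset.sum_congr rfl fun m _ => ?_
  rw [← Circle.coe_inv_eq_conj, ← Circle.coe_inv_eq_conj, ← AddChar.map_neg_eq_inv,
    ← AddChar.map_neg_eq_inv, ← Circle.coe_mul, ← Circle.coe_mul, ← AddChar.map_add_eq_mul,
    ← AddChar.map_add_eq_mul]
  congr 2
  ring

/-- The symbol of the finite factor of the frame operator. -/
noncomputable def finSymbol (y x z : ZMod q × ZMod q) : ℂ :=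
  finCoeff 0 z * (conj (ZMod.toCircle (z.1 * y.2) : ℂ) * finCoeff (z + y) x)

/-- The Moyal identity for the finite Heisenberg group. -/
lemma finCoeff_mul_finCoeff (y w x : ZMod q × ZMod q) : (q : ℂ) * (finCoeff y w * finCoeff w x) =
    ∑ n : ZMod q, ∑ m : ZMod q, finSymbol y x (n, m) * (conj (ZMod.toCircle (w.1 * m) : ℂ) *
      (ZMod.toCircle (n * w.2) : ℂ)) := by
  set S : ℂ := ((1 / √q : ℝ) : ℂ) with hS
  set e : ZMod q → ℂ := fun t => (ZMod.toCircle t : ℂ) with he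
  have hadd : ∀ a b, e (a + b) = e a * e b := fun a b => by
    simp only [he, AddChar.map_add_eq_mul, Circle.coe_mul]
  have hunit : ∀ a, e a * conj (e a) = 1 := fun a => circle_mul_conj_self _
  set h := finWindow q with hh
  have hconj : ∀ a, conj (h a) = h a := conj_finWindow
  have hsum : ∀ s t w : ZMod q, ∑ m : ZMod q, e (s * m) * conj (e (t * m)) * conj (e (w * m)) =
    if s = t + w then (q : ℂ) else 0 := sum_toCircle'
  let F : ZMod q → ZMod q → ZMod q → ℂ := fun n s t => S ^ 2 * (h s * h (s + n)) *
    (conj (e (n * y.2)) * (conj (e (t * y.2)) * h (t + (n + y.1)) * (e (t * x.2) * h (t + x.1)))) *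
    e (n * w.2)
  have h1 : ∀ n m, finSymbol y x (n, m) * (conj (e (w.1 * m)) * e (n * w.2)) =
      ∑ s, ∑ t, F n s t * (e (s * m) * conj (e (t * m)) * conj (e (w.1 * m))) := fun n m => by
    rw [finSymbol, finCoeff, finCoeff, ← hS, ← hh]
    simp only [Prod.fst_zero, Prod.snd_zero, mul_zero, AddChar.map_zero_eq_one, Circle.coe_one,
      one_mul, add_zero, map_mul, hconj, Prod.fst_add, Prod.snd_add]
    change S * (∑ s, h s * (e (s * m) * h (s + n))) * (conj (e (n * y.2)) *
      (S * ∑ t, conj (e (t * (m + y.2))) * h (t + (n + y.1)) * (e (t * x.2) * h (t + x.1)))) *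
      (conj (e (w.1 * m)) * e (n * w.2)) = _
    have h2 : ∀ t, conj (e (t * (m + y.2))) = conj (e (t * m)) * conj (e (t * y.2)) := fun t => by
      rw [mul_add, hadd, map_mul]
    simp only [h2]
    simp only [Finset.mul_sum, Finset.sum_mul]
    rw [Finset.sum_comm]
    refine Finset.sum_congr rfl fun s _ => Finset.sum_congr rfl fun t _ => ?_
    simp only [F]
    ring
  change _ = ∑ n, ∑ m, finSymbol y x (n, m) * (conj (e (w.1 * m)) * e (n * w.2))
  simp only [h1]
  -- Orthogonality of characters in `m` forces `s = t + w.1`; the substitution `a = t + n` then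
  -- matches the two sides.
  have h3 : ∀ n, ∑ m, ∑ s, ∑ t, F n s t * (e (s * m) * conj (e (t * m)) * conj (e (w.1 * m))) =
      ∑ t, F n (t + w.1) t * q := fun n => by
    rw [Finset.sum_comm, Finset.sum_congr rfl fun s _ => Finset.sum_comm, Finset.sum_comm]
    refine Finset.sum_congr rfl fun t _ => ?_
    simp only [← Finset.mul_sum, hsum, mul_ite, mul_zero, Finset.sum_ite_eq', Finset.mem_univ,
      if_true]
  simp only [h3]
  rw [finCoeff, finCoeff, ← hS, ← hh]
  change (q : ℂ) * (S * (∑ a, conj (e (a * y.2) * h (a + y.1)) * (e (a * w.2) * h (a + w.1))) *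
    (S * ∑ t, conj (e (t * w.2) * h (t + w.1)) * (e (t * x.2) * h (t + x.1)))) = _
  rw [Finset.sum_comm]
  have h4 : (q : ℂ) * (S * (∑ a, conj (e (a * y.2) * h (a + y.1)) * (e (a * w.2) * h (a + w.1))) *
      (S * ∑ t, conj (e (t * w.2) * h (t + w.1)) * (e (t * x.2) * h (t + x.1)))) =
      ∑ t, ∑ a, q * S ^ 2 * (conj (e (a * y.2) * h (a + y.1)) * (e (a * w.2) * h (a + w.1))) *
        (conj (e (t * w.2) * h (t + w.1)) * (e (t * x.2) * h (t + x.1))) := by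
    simp only [Finset.mul_sum, Finset.sum_mul]
    refine Finset.sum_congr rfl fun t _ => Finset.sum_congr rfl fun a _ => ?_
    ring
  rw [h4]
  refine Finset.sum_congr rfl fun t _ => ?_
  rw [← Equiv.sum_comp (Equiv.addLeft t)]
  refine Finset.sum_congr rfl fun n _ => ?_
  simp only [Equiv.coe_addLeft, F, map_mul, hconj, add_mul, hadd]
  rw [add_right_comm t w.1 n, ← add_assoc t n y.1]
  linear_combination (q * S ^ 2 * conj (e (t * y.2)) * conj (e (n * y.2)) * h (t + n + y.1) *
    e (n * w.2) * h (t + n + w.1) * h (t + w.1) * e (t * x.2) * h (t + x.1)) * hunit (t * w.2)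

end Heisenberg

/-! ### Poisson summation on the real factor -/

/-- A Gaussian times a character. -/
noncomputable def gaussChar (a b δ u : ℝ) : ℂ :=
  Complex.exp (-Real.pi * ((a - u) ^ 2 + (u - b) ^ 2) / 2 - Real.pi * Complex.I * u * δ)

lemma norm_gaussChar_le (a b δ u : ℝ) :
    ‖gaussChar a b δ u‖ ≤ Real.exp (-Real.pi * (u + -b) ^ 2 / 2) := by
  rw [gaussChar, Complex.norm_exp]
  refine Real.exp_le_exp.2 ?_
  have : (-Real.pi * ((a - u) ^ 2 + (u - b) ^ 2) / 2 - Real.pi * Complex.I * u * δ : ℂ) =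
    ((-Real.pi * ((a - u) ^ 2 + (u - b) ^ 2) / 2 : ℝ) : ℂ) + ((-Real.pi * u * δ : ℝ) : ℂ) * Complex.I := by
    push_cast
    ring
  rw [this]
  simp only [Complex.add_re, Complex.ofReal_re, Complex.re_ofReal_mul, Complex.I_re]
  have h : 0 ≤ Real.pi * (a - u) ^ 2 := by positivity
  nlinarith

lemma summable_norm_gaussChar {s : ℝ} (hs : 0 < s) (a b δ : ℝ) :
    Summable fun k : ℤ => ‖gaussChar a b δ (k * s)‖ := by
  obtain ⟨C, -, hC⟩ := exists_forall_sum_exp_neg_le hs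
  exact summable_of_sum_le (fun _ => norm_nonneg _) fun F =>
    (Finset.sum_le_sum fun k _ => norm_gaussChar_le _ _ _ _).trans (hC (-b) F)

lemma gaussChar_neg (a δ u : ℝ) : gaussChar (-a) 0 (-δ) (-u) = gaussChar a 0 δ u := by
  rw [gaussChar, gaussChar]
  congr 1
  push_cast
  ring

/-- Poisson summation for a Gaussian times a character. -/
lemma tsum_gaussChar_mul_exp {γ : ℝ} (hγ : 0 < γ) (a b δ θ : ℝ) :
    ∑' k : ℤ, gaussChar a b δ (k * √γ) * Complex.exp (-(2 * Real.pi * Complex.I * (k * θ))) =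
      ((√γ)⁻¹ : ℝ) * Complex.exp (-Real.pi * (a - b) ^ 2 / 4 + Real.pi * δ ^ 2 / 4 -
        Real.pi * Complex.I * (a + b) * δ / 2) *
      ∑' j : ℤ, gaussChar δ 0 (-(a + b)) ((j - θ) / √γ) := by
  have hsγ : 0 < √γ := Real.sqrt_pos.2 hγ
  have hsc : (√γ : ℂ) ≠ 0 := by exact_mod_cast hsγ.ne'
  have hsq : (√γ : ℂ) ^ 2 = γ := by
    rw [← Complex.ofReal_pow, Real.sq_sqrt hγ.le]
  -- The linear parameter collects the cross terms of the two Gaussians and the frequencies `δ` and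
  -- `θ`. The dual sum is later reindexed by `j ↦ -j`, so that it runs over the points `(j - θ) /
  -- √γ`.
  have h := Complex.tsum_exp_neg_quadratic (a := γ) (by simpa using hγ)
    (√γ * ((a + b) / 2) - Complex.I * (√γ * δ / 2 + θ))
  have hpow : (1 : ℂ) / (γ : ℂ) ^ (1 / 2 : ℂ) = (((√γ)⁻¹ : ℝ) : ℂ) := by
    rw [Real.sqrt_eq_rpow, Complex.ofReal_inv, Complex.ofReal_cpow hγ.le]
    norm_num
  rw [hpow] at h
  have hL : ∀ k : ℤ, gaussChar a b δ (k * √γ) *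
      Complex.exp (-(2 * Real.pi * Complex.I * (k * θ))) =
      Complex.exp (-Real.pi * (a ^ 2 + b ^ 2) / 2) * Complex.exp (-Real.pi * γ * k ^ 2 +
        2 * Real.pi * (√γ * ((a + b) / 2) - Complex.I * (√γ * δ / 2 + θ)) * k) := fun k => by
    rw [gaussChar, ← Complex.exp_add, ← Complex.exp_add, ← hsq]
    congr 1
    push_cast
    ring
  have hR : ∀ j : ℤ, Complex.exp (-Real.pi * (a ^ 2 + b ^ 2) / 2) *
      Complex.exp (-Real.pi / γ * (((-j : ℤ) : ℂ) + Complex.I *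
        (√γ * ((a + b) / 2) - Complex.I * (√γ * δ / 2 + θ))) ^ 2) =
      Complex.exp (-Real.pi * (a - b) ^ 2 / 4 + Real.pi * δ ^ 2 / 4 -
        Real.pi * Complex.I * (a + b) * δ / 2) * gaussChar δ 0 (-(a + b)) ((j - θ) / √γ) :=
    fun j => by
    rw [gaussChar, ← Complex.exp_add, ← Complex.exp_add, ← hsq]
    congr 1
    push_cast
    have e : (-(j : ℂ) + Complex.I * (√γ * ((a + b) / 2) - Complex.I * (√γ * δ / 2 + θ))) =
        √γ * (-((j - θ) / √γ) + δ / 2 + Complex.I * ((a + b) / 2)) := by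
      field_simp
      linear_combination (-(√γ * δ + 2 * θ : ℂ)) * Complex.I_sq
    rw [e]
    set z : ℂ := (j - θ) / √γ
    have e2 : (-Real.pi / (√γ : ℂ) ^ 2) * (√γ * (-z + δ / 2 + Complex.I * ((a + b) / 2))) ^ 2 =
        -Real.pi * (-z + δ / 2 + Complex.I * ((a + b) / 2)) ^ 2 := by
      field_simp
    rw [e2]
    linear_combination (-(Real.pi * (a + b) ^ 2 / 4 : ℂ)) * Complex.I_sq
  simp_rw [hL]
  rw [tsum_mul_left, h, mul_left_comm, ← tsum_mul_left, ← (Equiv.neg ℤ).tsum_eq]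
  simp only [Equiv.neg_apply]
  simp_rw [hR]
  rw [tsum_mul_left]
  exact (mul_assoc _ _ _).symm

/-! ### Janssen's identity for the window -/

namespace Heisenberg

variable {q : ℕ} [NeZero q]

/-- Summation over a residue class. -/
lemma tsum_ite_residue {p₀ : ℤ} {r : ZMod q} (hr : r * p₀ = 1) (g : ℤ → ℂ) (n : ZMod q) :
    ∑' k : ℤ, (if (k : ZMod q) * -r = n then g k else 0) = ∑' j : ℤ, g (j * q - p₀ * n.val) := by
  have hq : (q : ℤ) ≠ 0 := by exact_mod_cast NeZero.ne q
  have hcast : ((n.val : ℤ) : ZMod q) = n := by simp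
  have hinj : Function.Injective fun j : ℤ => j * q - p₀ * n.val := fun i j h => by
    simp only [sub_left_inj] at h
    exact mul_right_cancel₀ hq h
  rw [← hinj.tsum_eq]
  · refine tsum_congr fun j => if_pos ?_
    push_cast
    rw [CharP.cast_eq_zero, mul_zero, zero_sub, ZMod.natCast_zmod_val]
    linear_combination n * hr
  · intro k hk
    have h : (k : ZMod q) * -r = n := by
      by_contra h0
      exact hk (if_neg h0)
    have h2 : ((k + p₀ * n.val : ℤ) : ZMod q) = 0 := by
      push_cast
      rw [ZMod.natCast_zmod_val, ← h]
      linear_combination (-(k : ZMod q)) * hr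
    obtain ⟨j, hj⟩ := (ZMod.intCast_zmod_eq_zero_iff_dvd _ q).1 h2
    refine ⟨j, ?_⟩
    simp only
    linarith

/-- Every integer is `j q - p₀ n.val` for exactly one pair `(j, n)`. The finite frequencies and the
Poisson frequencies thus merge into a single sum over `D^⊥`. -/
lemma sum_mul_tsum_residue {p₀ : ℤ} {r : ZMod q} (hr : r * p₀ = 1) (Φ : ZMod q × ZMod q → ℂ)
    {g₁ g₂ : ℤ → ℂ} (h₁ : Summable fun k => ‖g₁ k‖) (h₂ : Summable fun k => ‖g₂ k‖) :
    ∑ n : ZMod q, ∑ m : ZMod q, Φ (n, m) * ((∑' j : ℤ, g₁ (j * q - p₀ * n.val)) *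
      ∑' j : ℤ, g₂ (j * q - p₀ * m.val)) =
    ∑' w : ℤ × ℤ, Φ (w.1 * -r, w.2 * -r) * (g₁ w.1 * g₂ w.2) := by
  have hs : ∀ {g : ℤ → ℂ}, (Summable fun k => ‖g k‖) → ∀ n : ZMod q,
      Summable fun k : ℤ => ‖if (k : ZMod q) * -r = n then g k else 0‖ := fun {g} h n =>
    h.of_nonneg_of_le (fun _ => norm_nonneg _) fun k => by split_ifs <;> simp
  have hprod : ∀ n m, (∑' j : ℤ, g₁ (j * q - p₀ * n.val)) * ∑' j : ℤ, g₂ (j * q - p₀ * m.val) =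
      ∑' w : ℤ × ℤ, (if (w.1 : ZMod q) * -r = n then g₁ w.1 else 0) *
        (if (w.2 : ZMod q) * -r = m then g₂ w.2 else 0) := fun n m => by
    rw [← tsum_ite_residue hr, ← tsum_ite_residue hr]
    exact tsum_mul_tsum_of_summable_norm (hs h₁ n) (hs h₂ m)
  have hsum : ∀ n m, Summable fun w : ℤ × ℤ => Φ (n, m) *
      ((if (w.1 : ZMod q) * -r = n then g₁ w.1 else 0) *
        (if (w.2 : ZMod q) * -r = m then g₂ w.2 else 0)) := fun n m =>
    (summable_mul_of_summable_norm (hs h₁ n) (hs h₂ m)).mul_left _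
  simp_rw [hprod, ← tsum_mul_left]
  rw [Finset.sum_congr rfl fun n _ => (Summable.tsum_finsetSum fun m _ => hsum n m).symm,
    ← Summable.tsum_finsetSum fun n _ => summable_sum fun m _ => hsum n m]
  refine tsum_congr fun w => ?_
  simp

/-- Here the two coordinates of the lattice variable `w` separate, so that Poisson summation can be
applied in each independently. -/
lemma realCoeff_mul_realCoeff (y w x : ℝ × ℝ) : realCoeff y w * realCoeff w x =
    (1 / 2) * Complex.exp (-Real.pi * Complex.I * (x.1 * x.2 - y.1 * y.2)) *
      (gaussChar x.1 y.1 (x.2 - y.2) w.1 * gaussChar x.2 y.2 (-(x.1 - y.1)) w.2) := by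
  have h : (((√2)⁻¹ : ℝ) : ℂ) * (((√2)⁻¹ : ℝ) : ℂ) = 1 / 2 := by
    rw [← Complex.ofReal_mul, ← mul_inv, Real.mul_self_sqrt (by norm_num)]
    push_cast
    norm_num
  rw [realCoeff, realCoeff, gaussChar, gaussChar, mul_mul_mul_comm, h, ← Complex.exp_add,
    ← Complex.exp_add, mul_assoc (1 / 2 : ℂ), ← Complex.exp_add]
  congr 2
  push_cast
  ring

lemma realCoeff_symbol (y x z : ℝ × ℝ) :
    realCoeff 0 z * (conj (Real.fourierChar (z.1 * y.2) : ℂ) * realCoeff (z + y) x) =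
    (1 / 2) * Complex.exp (-Real.pi * Complex.I * ((x.1 + y.1) * (x.2 - y.2))) *
      (gaussChar (x.1 - y.1) 0 (x.2 + y.2) z.1 * gaussChar (x.2 - y.2) 0 (-(x.1 + y.1)) z.2) := by
  have h : (((√2)⁻¹ : ℝ) : ℂ) * (((√2)⁻¹ : ℝ) : ℂ) = 1 / 2 := by
    rw [← Complex.ofReal_mul, ← mul_inv, Real.mul_self_sqrt (by norm_num)]
    push_cast
    norm_num
  rw [realCoeff, realCoeff, gaussChar, gaussChar, mul_left_comm (conj _), mul_mul_mul_comm, h,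
    ← Complex.exp_add, mul_assoc (1 / 2 : ℂ), ← Complex.exp_add, Real.fourierChar_apply,
    ← Complex.exp_conj, ← Complex.exp_add, ← Complex.exp_add]
  congr 2
  simp only [map_mul, Complex.conj_ofReal, Complex.conj_I]
  push_cast
  simp
  ring

lemma conj_toCircle_eq_exp (p₀ k : ℤ) (m : ZMod q) :
    conj (ZMod.toCircle ((k : ZMod q) * (p₀ : ZMod q) * m) : ℂ) =
      Complex.exp (-(2 * Real.pi * Complex.I * (k * (p₀ * m.val / q : ℝ)))) := by
  have h : (k : ZMod q) * (p₀ : ZMod q) * m = ((k * p₀ * m.val : ℤ) : ZMod q) := by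
    push_cast
    rw [ZMod.natCast_zmod_val]
  rw [h, ZMod.toCircle_intCast, ← Complex.exp_conj]
  congr 1
  simp only [map_mul, map_div₀, Complex.conj_ofReal, Complex.conj_I, map_ofNat, map_intCast,
    map_natCast]
  push_cast
  ring

lemma toCircle_eq_exp (p₀ k : ℤ) (m : ZMod q) :
    (ZMod.toCircle (m * ((k : ZMod q) * (p₀ : ZMod q))) : ℂ) =
      Complex.exp (-(2 * Real.pi * Complex.I * (k * (-(p₀ * m.val / q) : ℝ)))) := by
  have h := congrArg conj (conj_toCircle_eq_exp p₀ k m)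
  rw [Complex.conj_conj, mul_comm _ m] at h
  rw [h, ← Complex.exp_conj]
  congr 1
  simp only [map_mul, map_neg, Complex.conj_ofReal, Complex.conj_I, map_ofNat, map_intCast]
  push_cast
  ring

/-- The lattice sum attached to the matrix coefficients of the window. -/
lemma tsum_inner_window {γ : ℝ} (hγ : 0 < γ) {p₀ : ℤ} {r : ZMod q} (hr : r * p₀ = 1) (x y : G q) :
    ∑' i : ℤ × ℤ, ((q * γ : ℝ) : ℂ) * (inner ℂ (heis y (window q))
      (heis (grid √γ (p₀ : ZMod q) i) (window q)) *
      inner ℂ (heis (grid √γ (p₀ : ZMod q) i) (window q)) (heis x (window q))) =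
    ∑' j : ℤ × ℤ, (heisRep q).coeff (window q) (grid (1 / (q * √γ)) (-r) j) *
      inner ℂ (heis (grid (1 / (q * √γ)) (-r) j) (heis y (window q))) (heis x (window q)) := by
  obtain ⟨⟨x1, n1⟩, ⟨x2, n2⟩⟩ := x
  obtain ⟨⟨y1, m1⟩, ⟨y2, m2⟩⟩ := y
  have hsγ : 0 < √γ := Real.sqrt_pos.2 hγ
  have hq : (0 : ℝ) < q := by exact_mod_cast Nat.pos_of_neZero q
  have ha : 0 < 1 / (q * √γ) := by positivity
  set a := 1 / (q * √γ) with had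
  set Φ : ZMod q × ZMod q → ℂ := finSymbol (m1, m2) (n1, n2) with hΦ
  set Q₁ : ℤ → ℂ := fun k => gaussChar (x1 - y1) 0 (x2 + y2) (k * a) with hQ₁
  set Q₂ : ℤ → ℂ := fun k => gaussChar (x2 - y2) 0 (-(x1 + y1)) (k * a) with hQ₂
  have hR : ∀ j : ℤ × ℤ, (heisRep q).coeff (window q) (grid a (-r) j) *
      inner ℂ (heis (grid a (-r) j) (heis ((y1, m1), (y2, m2)) (window q)))
        (heis ((x1, n1), (x2, n2)) (window q)) =
      (1 / 2) * Complex.exp (-Real.pi * Complex.I * ((x1 + y1) * (x2 - y2))) *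
        (Φ (j.1 * -r, j.2 * -r) * (Q₁ j.1 * Q₂ j.2)) := fun j => by
    have e := (heisRep q).inner_op_op (grid a (-r) j) ((y1, m1), (y2, m2)) (window q)
      (heis ((x1, n1), (x2, n2)) (window q))
    change inner ℂ (heis (grid a (-r) j) (heis ((y1, m1), (y2, m2)) (window q)))
        (heis ((x1, n1), (x2, n2)) (window q)) = conj (bichar (grid a (-r) j) ((y1, m1), (y2, m2)) : ℂ) *
        inner ℂ (heis (grid a (-r) j + ((y1, m1), (y2, m2))) (window q))
        (heis ((x1, n1), (x2, n2)) (window q)) at e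
    rw [e, coeff_window, inner_heis_window, grid_apply, bichar, pairing, Circle.coe_mul, map_mul]
    have h := realCoeff_symbol (y1, y2) (x1, x2) (j.1 * a, j.2 * a)
    rw [hΦ, finSymbol]
    simp only [Prod.mk_add_mk] at h ⊢
    linear_combination (finCoeff 0 ((j.1 : ZMod q) * -r, (j.2 : ZMod q) * -r) *
      (conj (ZMod.toCircle ((j.1 : ZMod q) * -r * m2) : ℂ) *
      finCoeff ((j.1 : ZMod q) * -r + m1, (j.2 : ZMod q) * -r + m2) (n1, n2))) * h
  simp_rw [hR]
  have hsQ₁ : Summable fun k => ‖Q₁ k‖ := summable_norm_gaussChar ha _ _ _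
  have hsQ₂ : Summable fun k => ‖Q₂ k‖ := summable_norm_gaussChar ha _ _ _
  conv_rhs => rw [tsum_mul_left, ← sum_mul_tsum_residue hr Φ hsQ₁ hsQ₂]
  set P₁ : ℤ → ℂ := fun k => gaussChar x1 y1 (x2 - y2) (k * √γ) with hP₁
  set P₂ : ℤ → ℂ := fun k => gaussChar x2 y2 (-(x1 - y1)) (k * √γ) with hP₂
  -- The factor `q` is used up by the finite Moyal identity; `γ` will cancel the two factors `1/√γ`
  -- from Poisson summation.
  have hL : ∀ i : ℤ × ℤ, ((q * γ : ℝ) : ℂ) * (inner ℂ (heis ((y1, m1), (y2, m2)) (window q))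
      (heis (grid √γ (p₀ : ZMod q) i) (window q)) *
      inner ℂ (heis (grid √γ (p₀ : ZMod q) i) (window q)) (heis ((x1, n1), (x2, n2)) (window q))) =
      ∑ n : ZMod q, ∑ m : ZMod q, γ * ((1 / 2) *
        Complex.exp (-Real.pi * Complex.I * (x1 * x2 - y1 * y2))) * Φ (n, m) *
        ((P₁ i.1 * conj (ZMod.toCircle ((i.1 : ZMod q) * (p₀ : ZMod q) * m) : ℂ)) *
        (P₂ i.2 * (ZMod.toCircle (n * ((i.2 : ZMod q) * (p₀ : ZMod q))) : ℂ))) := fun i => by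
    have h1 := finCoeff_mul_finCoeff (m1, m2) ((i.1 : ZMod q) * p₀, (i.2 : ZMod q) * p₀) (n1, n2)
    have h2 := realCoeff_mul_realCoeff (y1, y2) (i.1 * √γ, i.2 * √γ) (x1, x2)
    rw [inner_heis_window, inner_heis_window, grid_apply]
    simp only at h1 h2 ⊢
    have h3 : ∀ n m : ZMod q, γ * ((1 / 2) *
        Complex.exp (-Real.pi * Complex.I * (x1 * x2 - y1 * y2))) * Φ (n, m) *
        ((P₁ i.1 * conj (ZMod.toCircle ((i.1 : ZMod q) * (p₀ : ZMod q) * m) : ℂ)) *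
        (P₂ i.2 * (ZMod.toCircle (n * ((i.2 : ZMod q) * (p₀ : ZMod q))) : ℂ))) =
        (γ * ((1 / 2) * Complex.exp (-Real.pi * Complex.I * (x1 * x2 - y1 * y2)) *
          (P₁ i.1 * P₂ i.2))) * (Φ (n, m) * (conj (ZMod.toCircle ((i.1 : ZMod q) * (p₀ : ZMod q) * m) : ℂ) *
          (ZMod.toCircle (n * ((i.2 : ZMod q) * (p₀ : ZMod q))) : ℂ))) := fun n m => by ring
    simp only [h3, ← Finset.mul_sum]
    rw [← h1, ← h2]
    push_cast
    ring
  have hS1 : ∀ m : ZMod q, Summable fun k : ℤ =>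
      ‖P₁ k * conj (ZMod.toCircle ((k : ZMod q) * (p₀ : ZMod q) * m) : ℂ)‖ := fun m => by
    refine (summable_norm_gaussChar hsγ x1 y1 (x2 - y2)).congr fun k => ?_
    rw [norm_mul, RCLike.norm_conj, Circle.norm_coe, mul_one]
  have hS2 : ∀ n : ZMod q, Summable fun k : ℤ =>
      ‖P₂ k * (ZMod.toCircle (n * ((k : ZMod q) * (p₀ : ZMod q))) : ℂ)‖ := fun n => by
    refine (summable_norm_gaussChar hsγ x2 y2 (-(x1 - y1))).congr fun k => ?_
    rw [norm_mul, Circle.norm_coe, mul_one]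
  have hS : ∀ n m : ZMod q, Summable fun i : ℤ × ℤ => γ * ((1 / 2) *
        Complex.exp (-Real.pi * Complex.I * (x1 * x2 - y1 * y2))) * Φ (n, m) *
        ((P₁ i.1 * conj (ZMod.toCircle ((i.1 : ZMod q) * (p₀ : ZMod q) * m) : ℂ)) *
        (P₂ i.2 * (ZMod.toCircle (n * ((i.2 : ZMod q) * (p₀ : ZMod q))) : ℂ))) := fun n m =>
    (summable_mul_of_summable_norm (hS1 m) (hS2 n)).mul_left _
  simp_rw [hL]
  rw [Summable.tsum_finsetSum fun n _ => summable_sum fun m _ => hS n m, Finset.mul_sum]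
  refine Finset.sum_congr rfl fun n _ => ?_
  rw [Summable.tsum_finsetSum fun m _ => hS n m, Finset.mul_sum]
  refine Finset.sum_congr rfl fun m _ => ?_
  rw [tsum_mul_left, ← tsum_mul_tsum_of_summable_norm (hS1 m) (hS2 n)]
  -- Poisson summation exchanges the coordinates: the sum over the first one gives `Q₂`, and in
  -- `hT2` the second gives `Q₁`. The finite frequency `p₀ m / q` shifts the dual lattice to the
  -- points `(j q - p₀ m) / (q√γ)`.
  have hT1 : ∑' k : ℤ, P₁ k * conj (ZMod.toCircle ((k : ZMod q) * (p₀ : ZMod q) * m) : ℂ) =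
      ((√γ)⁻¹ : ℝ) * Complex.exp (-Real.pi * (x1 - y1) ^ 2 / 4 + Real.pi * (x2 - y2) ^ 2 / 4 -
        Real.pi * Complex.I * (x1 + y1) * (x2 - y2) / 2) * ∑' j : ℤ, Q₂ (j * q - p₀ * m.val) := by
    have h := tsum_gaussChar_mul_exp hγ x1 y1 (x2 - y2) (p₀ * m.val / q)
    simp_rw [conj_toCircle_eq_exp]
    rw [h]
    push_cast
    congr 1
    refine tsum_congr fun j => ?_
    rw [hQ₂]
    simp only
    congr 1
    rw [had]
    push_cast
    field_simp
  have hT2 : ∑' k : ℤ, P₂ k * (ZMod.toCircle (n * ((k : ZMod q) * (p₀ : ZMod q))) : ℂ) =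
      ((√γ)⁻¹ : ℝ) * Complex.exp (-Real.pi * (x2 - y2) ^ 2 / 4 + Real.pi * (x1 - y1) ^ 2 / 4 +
        Real.pi * Complex.I * (x2 + y2) * (x1 - y1) / 2) * ∑' j : ℤ, Q₁ (j * q - p₀ * n.val) := by
    have h := tsum_gaussChar_mul_exp hγ x2 y2 (-(x1 - y1)) (-(p₀ * n.val / q))
    simp_rw [toCircle_eq_exp]
    rw [h]
    congr 1
    · congr 2
      push_cast
      ring
    -- The finite character enters here with the opposite sign; `j ↦ -j` together with
    -- `gaussChar_neg` restores the same residue class.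
    · rw [← (Equiv.neg ℤ).tsum_eq]
      refine tsum_congr fun j => ?_
      rw [hQ₁]
      simp only [Equiv.neg_apply]
      rw [← gaussChar_neg (x1 - y1)]
      congr 1
      rw [had]
      push_cast
      field_simp
      ring
  rw [hT1, hT2]
  have hγ2 : (((√γ)⁻¹ : ℝ) : ℂ) * (((√γ)⁻¹ : ℝ) : ℂ) * γ = 1 := by
    rw [← Complex.ofReal_mul, ← mul_inv, Real.mul_self_sqrt hγ.le, ← Complex.ofReal_mul,
      inv_mul_cancel₀ hγ.ne', Complex.ofReal_one]
  have hexp : Complex.exp (-Real.pi * Complex.I * (x1 * x2 - y1 * y2)) *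
      (Complex.exp (-Real.pi * (x1 - y1) ^ 2 / 4 + Real.pi * (x2 - y2) ^ 2 / 4 -
        Real.pi * Complex.I * (x1 + y1) * (x2 - y2) / 2) *
      Complex.exp (-Real.pi * (x2 - y2) ^ 2 / 4 + Real.pi * (x1 - y1) ^ 2 / 4 +
        Real.pi * Complex.I * (x2 + y2) * (x1 - y1) / 2)) =
      Complex.exp (-Real.pi * Complex.I * ((x1 + y1) * (x2 - y2))) := by
    rw [← Complex.exp_add, ← Complex.exp_add]
    congr 1
    ring
  rw [← hexp]
  linear_combination (Φ (n, m) * (1 / 2) * Complex.exp (-Real.pi * Complex.I * (x1 * x2 - y1 * y2)) *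
      (Complex.exp (-Real.pi * (x1 - y1) ^ 2 / 4 + Real.pi * (x2 - y2) ^ 2 / 4 -
        Real.pi * Complex.I * (x1 + y1) * (x2 - y2) / 2) *
      Complex.exp (-Real.pi * (x2 - y2) ^ 2 / 4 + Real.pi * (x1 - y1) ^ 2 / 4 +
        Real.pi * Complex.I * (x2 + y2) * (x1 - y1) / 2)) *
      (∑' j : ℤ, Q₁ (j * q - p₀ * n.val)) * ∑' j : ℤ, Q₂ (j * q - p₀ * m.val)) * hγ2

end Heisenberg

/-! ### Assembly of the invariant idempotent and the theorem -/

namespace Heisenberg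

variable {q : ℕ} [NeZero q]

/-- The rotation by a right angle of `ℤ²`. -/
def rotateIndex : ℤ × ℤ ≃ ℤ × ℤ where
  toFun w := (-w.2, w.1)
  invFun w := (w.2, -w.1)
  left_inv w := by simp
  right_inv w := by simp

/-- The witness is `qγ ⟨π_w φ, a⁻¹ φ⟩` on `D`. The normalisation `qγ` is the one required by
Janssen's identity, and biorthogonality makes it the value at `0`. -/
lemma exists_isInvariantIdempotent {γ : ℝ} (hγ : 0 < γ) (hγ1 : γ < 0.948 / (q : ℝ) ^ 2) {p₀ : ℤ}
    {r : ZMod q} (hr : r * p₀ = 1) : ∃ E, RotationAlgebra.IsInvariantIdempotent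
      (Real.fourierChar γ * ZMod.toCircle ((p₀ : ZMod q) * (p₀ : ZMod q))) E ∧ E 0 = ((q * γ : ℝ) : ℂ) := by
  have hsγ : 0 < √γ := Real.sqrt_pos.2 hγ
  have hq : (0 : ℝ) < q := by exact_mod_cast Nat.pos_of_neZero q
  have hs := (summable_norm_coeff_grid (q := q) (a := 1 / (q * √γ)) (by positivity) (-r)).1
  have hlt := tsum_norm_coeff_grid_lt hγ hγ1 (-r)
  have hu := (heisRep q).isUnit_frame hs hlt
  obtain ⟨ψ, hψ⟩ : ∃ ψ, (heisRep q).frame (window q) (grid (1 / (q * √γ)) (-r)) ψ = window q :=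
    ⟨hu.unit⁻¹.1 (window q), by
      rw [← mul_apply_eq_comp, hu.mul_val_inv, one_apply_eq_self]⟩
  have hW : ∀ i j, (heisRep q).β (grid √γ (p₀ : ZMod q) i) (grid (1 / (q * √γ)) (-r) j) =
      (heisRep q).β (grid (1 / (q * √γ)) (-r) j) (grid √γ (p₀ : ZMod q) i) := fun i j =>
    (bichar_grid_grid hγ hr i j).trans (bichar_grid_grid' hγ hr i j).symm
  obtain ⟨C, hC⟩ := exists_sum_norm_coeff_le (q := q) hsγ (p₀ : ZMod q)
  have hκ : Summable fun i => ‖inner ℂ ((heisRep q).op (grid √γ (p₀ : ZMod q) i) (window q)) ψ‖ :=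
    summable_of_sum_le (fun _ => norm_nonneg _)
      ((heisRep q).sum_norm_dual_le hs hlt hψ (grid √γ (p₀ : ZMod q)) fun j F => hC _ F)
  have hsum : ∀ x, Summable fun i =>
      ‖(heisRep q).coeff (window q) (grid √γ (p₀ : ZMod q) i - x)‖ := fun x => by
    simp_rw [sub_eq_add_neg]
    exact summable_of_sum_le (fun _ => norm_nonneg _) (hC (-x))
  have hβ : ∀ i j, (heisRep q).β (grid √γ (p₀ : ZMod q) i) (grid √γ (p₀ : ZMod q) j) =
      (Real.fourierChar γ * ZMod.toCircle ((p₀ : ZMod q) * (p₀ : ZMod q))) ^ (i.1 * j.2) := fun i j => by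
    have h := bichar_grid √γ √γ (p₀ : ZMod q) (p₀ : ZMod q) i j
    rwa [Real.mul_self_sqrt hγ.le] at h
  refine ⟨fun i => ((q * γ : ℝ) : ℂ) *
    inner ℂ ((heisRep q).op (grid √γ (p₀ : ZMod q) i) (window q)) ψ, ⟨?_, ?_, ?_, ?_⟩, ?_⟩
  · simpa only [norm_mul] using hκ.mul_left ‖((q * γ : ℝ) : ℂ)‖
  · intro w
    have h := (heisRep q).tsum_twisted_dual hs hψ hW hlt (Complex.conj_ofReal (q * γ)) hsum hκ
      (fun x y => tsum_inner_window hγ hr x y) w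
    conv_rhs => rw [← h]
    rw [← tsum_mul_left]
    refine tsum_congr fun l => ?_
    rw [hβ]
    ring
  · intro w
    rw [(heisRep q).inner_dual_neg hs hψ hW, hβ, map_mul conj, Complex.conj_ofReal]
    ring
  · intro w
    have h := (heisRep q).inner_dual_symm hs hlt hψ (rotate q) rotateIndex
      (fun j => rotate_grid _ _ _) bichar_rotate coeff_window_rotate (grid √γ (p₀ : ZMod q) w)
    rw [hβ, rotate_grid] at h
    refine (congrArg _ h).trans ?_
    ring
  · beta_reduce
    rw [map_zero, (heisRep q).op_zero, (heisRep q).inner_dual_self hs hlt hψ, mul_one]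

lemma fourierChar_mul_toCircle (γ : ℝ) (n : ℤ) :
    Real.fourierChar γ * ZMod.toCircle (n : ZMod q) = RotationAlgebra.phase (γ + n / q) := by
  ext
  rw [Circle.coe_mul, Real.fourierChar_apply, ZMod.toCircle_intCast, ← Complex.exp_add,
    RotationAlgebra.phase, Circle.coe_exp]
  congr 1
  push_cast
  ring

end Heisenberg

theorem proposition2p1 (α : ℝ) (hα0 : 0 < α) (hα1 : α < 1) (q : ℕ) [NeZero q] (hq : 2 ≤ q) (p : ℤ)
    (hpq : IsCoprime p (q : ℤ)) :
    (0 < α - p / q → α - p / q < 0.948 / (q : ℝ) ^ 2 →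
      ∀ p₀ : ℤ, p ≡ p₀ ^ 2 [ZMOD q] →
        IsUnit (Heisenberg.thetaElement q (α - p / q) p₀) ∧
        ∃ e ∈ RotationAlgebra.fixedAlgebra α, IsStarProjection e ∧
          RotationAlgebra.trace α e = ((q * α - p : ℝ) : ℂ)) ∧
    (0 < p / q - α → p / q - α < 0.948 / (q : ℝ) ^ 2 →
      ∀ p₁ : ℤ, p ≡ -p₁ ^ 2 [ZMOD q] →
        IsUnit (Heisenberg.thetaElement q (p / q - α) p₁) ∧
        ∃ e ∈ RotationAlgebra.fixedAlgebra α, IsStarProjection e ∧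
          RotationAlgebra.trace α e = ((p - q * α : ℝ) : ℂ)) := by
  have hq0 : (q : ℝ) ≠ 0 := by exact_mod_cast NeZero.ne q
  have hunit : IsUnit (p : ZMod q) := (ZMod.coe_int_isUnit_iff_isCoprime p q).2 hpq.symm
  constructor
  · intro h0 h1 p₀ hp
    have hpz : (p : ZMod q) = p₀ * p₀ := by
      have := (ZMod.intCast_eq_intCast_iff p (p₀ ^ 2) q).2 hp
      rw [this]; push_cast; ring
    rw [hpz] at hunit
    -- Coprimality enters only here: `p₀² = p` is a unit modulo `q`, hence so is `p₀`, and its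
    -- inverse `r` parametrises `D^⊥`.
    obtain ⟨r, hr⟩ := (isUnit_of_mul_isUnit_left hunit).exists_left_inv
    refine ⟨Heisenberg.isUnit_thetaElement h0 h1 hr, ?_⟩
    obtain ⟨E, hE, hE0⟩ := Heisenberg.exists_isInvariantIdempotent h0 h1 hr
    rw [← hpz, Heisenberg.fourierChar_mul_toCircle, sub_add_cancel] at hE
    obtain ⟨e, he, hep, het⟩ := RotationAlgebra.exists_projection hE
    refine ⟨e, he, hep, ?_⟩
    rw [het, hE0]
    congr 1
    field_simp
  · intro h0 h1 p₁ hp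
    have hpz : ((-p : ℤ) : ZMod q) = p₁ * p₁ := by
      have := (ZMod.intCast_eq_intCast_iff p (-p₁ ^ 2) q).2 hp
      rw [Int.cast_neg, this]; push_cast; ring
    have hunit' : IsUnit ((-p : ℤ) : ZMod q) := by rw [Int.cast_neg]; exact hunit.neg
    rw [hpz] at hunit'
    obtain ⟨r, hr⟩ := (isUnit_of_mul_isUnit_left hunit').exists_left_inv
    refine ⟨Heisenberg.isUnit_thetaElement h0 h1 hr, ?_⟩
    obtain ⟨E, hE, hE0⟩ := Heisenberg.exists_isInvariantIdempotent h0 h1 hr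
    -- The cocycle on `D` has angle `γ' + p₁²/q`, which is `-α` modulo 1, so the version with
    -- inverse phase applies.
    have hphase : RotationAlgebra.phase (p / q - α + (-p : ℤ) / q) = (RotationAlgebra.phase α)⁻¹ := by
      have : (p / q - α + (-p : ℤ) / q : ℝ) = -α := by push_cast; ring
      rw [this, RotationAlgebra.phase, RotationAlgebra.phase, mul_neg, Circle.exp_neg]
    rw [← hpz, Heisenberg.fourierChar_mul_toCircle, hphase] at hE
    obtain ⟨e, he, hep, het⟩ := RotationAlgebra.exists_projection_inv hE
    refine ⟨e, he, hep, ?_⟩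
    rw [het, hE0]
    congr 1
    field_simp
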